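/- For a function $f$ analytic at $0$ write $[z^n]f$ for its $n$-th Taylor coefficient at $0$. The Hadamard product of two such functions is $(f\odot g)(z)=\sum_{n\ge 0}([z^n]f)([z^n]g)\,z^n$. For $\eta>0$ and $0<\phi<\pi/2$ let $$\Delta(\phi,\eta)=\{z\in\mathbb C:\ |z|<1+\eta,\ |\operatorname{Arg}(z-1)|>\phi\}$$ (so $1\notin\Delta(\phi,\eta)$). A function defined by a Taylor series with radius of convergence $1$ is called $\Delta$-regular if it can be continued analytically to some $\Delta(\phi,\eta)$. Given complex numbers $c_i$ and pairwise distinct real exponents $\alpha_i$ ($i\in I$, $I$ infinite), only finitely many of which lie below any given real number, we say that $f$ has the infinite $\Delta$-expansion $f(z)\sim\sum_{i\in I}c_i(1-z)^{\alpha_i}$ if $f$ is $\Delta$-regular and there is a domain $\Delta(\phi,\eta)$ to which $f$ continues analytically and in which, for every real $A$, $$f(z)=\sum_{i:\ \alpha_i<A}c_i(1-z)^{\alpha_i}+O(|1-z|^A)\qquad\text{uniformly in } z\in\Delta(\phi,\eta).$$ Powers of $1-z$ are principal branches, and $x^{\overline{k}}=x(x+1)\cdots(x+k-1)$ for integers $k\ge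 0$. **Proposition.** Let $a,b$ be real numbers such that none of $a$, $b$, $a+b$ is an integer. Then for $|z|<1$ $$(1-z)^a\odot(1-z)^b={}_2F_1[-a,-b;1;z]=\sum_{n\ge0}\frac{(-a)^{\overline n}(-b)^{\overline n}}{n!}\,\frac{z^n}{n!}.$$ This function is $\Delta$-regular, and it has an infinite $\Delta$-expansion with exponent scale $\{0,1,2,\ldots\}\cup\{a+b+1,a+b+2,\ldots\}$, namely $$(1-z)^a\odot(1-z)^b\ \sim\ \sum_{k\ge0}\lambda_k^{(a,b)}\frac{(1-z)^k}{k!}+\sum_{k\ge0}\mu_k^{(a,b)}\frac{(1-z)^{a+b+1+k}}{k!},$$ where $$\lambda_k^{(a,b)}=\frac{\Gamma(1+a+b)}{\Gamma(1+a)\Gamma(1+b)}\,\frac{(-a)^{\overline k}(-b)^{\overline k}}{(-a-b)^{\overline k}},\qquad \mu_k^{(a,b)}=\frac{\Gamma(-a-b-1)}{\Gamma(-a)\Gamma(-b)}\,\frac{(1+a)^{\overline k}(1+b)^{\overline k}}{(2+a+b)^{\overline k}}.$$ -/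

import Mathlib

open Asymptotics

noncomputable section

/-- The indented disc `Δ(φ, η) = {z : |z| < 1 + η, |Arg (z - 1)| > φ}`.
For `φ > 0` it does not contain the point `1`, since `Complex.arg 0 = 0`. -/
def deltaDomain (φ η : ℝ) : Set ℂ :=
  {z | ‖z‖ < 1 + η ∧ φ < |Complex.arg (z - 1)|}

/-- `f` is given on the open unit disc by a power series about `0` whose radius of convergence is
exactly `1`. -/
def IsTaylorOfRadiusOne (f : ℂ → ℂ) : Prop :=
  ∃ p : FormalMultilinearSeries ℂ ℂ ℂ, p.radius = 1 ∧ HasFPowerSeriesOnBall f p 0 1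

/-- `F` is an analytic continuation to `Δ(φ, η)` of the restriction of `f` to the unit disc. -/
def IsDeltaContinuation (f : ℂ → ℂ) (φ η : ℝ) (F : ℂ → ℂ) : Prop :=
  DifferentiableOn ℂ F (deltaDomain φ η) ∧ Set.EqOn F f (Metric.ball 0 1)

/-- `f` is `Δ`-regular: it is defined by a Taylor series of radius of convergence `1` and continues
analytically to some `Δ(φ, η)` with `0 < φ < π / 2` and `η > 0`. -/
def IsDeltaRegular (f : ℂ → ℂ) : Prop :=
  IsTaylorOfRadiusOne f ∧
    ∃ φ η : ℝ, 0 < φ ∧ φ < Real.pi / 2 ∧ 0 < η ∧ ∃ F : ℂ → ℂ, IsDeltaContinuation f φ η F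

/-- The finite singular expansion
`F z = ∑ i ∈ s, c i * (1 - z) ^ α i + O(|1 - z| ^ A)`, uniformly for `z` in `Δ(φ, η)`
(principal branches), with `A` larger than all the exponents used. -/
def HasSingularExpansionOn {ι : Type*} (F : ℂ → ℂ) (φ η : ℝ) (s : Finset ι)
    (c : ι → ℂ) (α : ι → ℝ) (A : ℝ) : Prop :=
  (∀ i ∈ s, α i < A) ∧
    (fun z : ℂ => F z - ∑ i ∈ s, c i * (1 - z) ^ (α i : ℂ))
      =O[Filter.principal (deltaDomain φ η)] fun z : ℂ => ‖1 - z‖ ^ A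

/-- The infinite `Δ`-expansion `f z ∼ ∑ i, c i * (1 - z) ^ α i` over a family `α` of pairwise distinct
real exponents: `f` is `Δ`-regular and, in one and the same domain `Δ(φ, η)`, for every real `A`
only finitely many exponents are below `A`, and the terms with these exponents form a singular
expansion with error `O(|1 - z| ^ A)`. -/
def HasInfiniteDeltaExpansion {ι : Type*} (f : ℂ → ℂ) (c : ι → ℂ) (α : ι → ℝ) : Prop :=
  IsTaylorOfRadiusOne f ∧ Infinite ι ∧ Function.Injective α ∧
    ∃ φ η : ℝ, 0 < φ ∧ φ < Real.pi / 2 ∧ 0 < η ∧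
      ∃ F : ℂ → ℂ, IsDeltaContinuation f φ η F ∧
        ∀ A : ℝ, ∃ s : Finset ι, (∀ i, i ∈ s ↔ α i < A) ∧ HasSingularExpansionOn F φ η s c α A

/-- The Taylor coefficient `[z ^ n] f(z)` at the origin. -/
def taylorCoeffZero (f : ℂ → ℂ) (n : ℕ) : ℂ :=
  iteratedDeriv n f 0 / (n.factorial : ℂ)

/-- The Hadamard product of two functions analytic at the origin, as the sum of the termwise product
of their Taylor series (of interest at points where that series converges). -/
def hadamardProduct (f g : ℂ → ℂ) (z : ℂ) : ℂ :=
  ∑' n : ℕ, taylorCoeffZero f n * taylorCoeffZero g n * z ^ n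

/-- The function `z ↦ (1 - z) ^ a` (principal branch). -/
def oneSubPow (a : ℝ) (z : ℂ) : ℂ :=
  (1 - z) ^ (a : ℂ)

/-- The rising factorial `x (x + 1) ⋯ (x + k - 1)`. -/
def rising (x : ℝ) (k : ℕ) : ℝ :=
  ∏ i ∈ Finset.range k, (x + i)

/-- The coefficients of `(1 - z) ^ k / k!`. -/
def lambdaCoeff (a b : ℝ) (k : ℕ) : ℝ :=
  Real.Gamma (1 + a + b) / (Real.Gamma (1 + a) * Real.Gamma (1 + b)) *
    (rising (-a) k * rising (-b) k / rising (-a - b) k)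

/-- The coefficients of `(1 - z) ^ (a + b + 1 + k) / k!`. -/
def muCoeff (a b : ℝ) (k : ℕ) : ℝ :=
  Real.Gamma (-a - b - 1) / (Real.Gamma (-a) * Real.Gamma (-b)) *
    (rising (1 + a) k * rising (1 + b) k / rising (2 + a + b) k)

end

/-!
The Hadamard product is `₂F₁ (-a) (-b) 1` because the Taylor coefficients of `(1 - z) ^ a` are
`(-a)ₙ / n!`, so the expansion at `1` is Gauss's formula connecting the local solutions of the
hypergeometric equation at `0` and at `1`.

For the connection formula, `₂F₁ α β γ` and `₂F₁ (α + 1) β γ` solve a first order system on the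
intersection of the unit discs about `0` and `1`. So does a suitable combination of the solutions
with exponents `0` and `γ - α - β` at `1`, and the Casoratian of two solutions is constant up to an
explicit factor. Hence a solution is determined by its leading behaviour at `1`, which for the two
hypergeometric functions is given by Euler's integral (Gauss's summation) and by an Abelian
comparison with a binomial series. Both this comparison and the convergence of Euler's integral
restrict the parameters; contiguity relations remove the restriction by shifting `α` and `β`.

Euler's integral and contiguity also continue `₂F₁ α β γ` to the plane cut along `[1, ∞)`, and the
connection formula follows it there near `1`, where truncating the two power series in `1 - z` gives
the expansion. The rest of a `Δ`-domain lies in a compact subset of the cut plane, on which the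
error bound is automatic.
-/

open Filter Topology Set

section UnitDiscSeries

open scoped Nat

/-- `f` is the sum of the power series `∑ c n * z ^ n` on the open unit disc. -/
def HasUnitDiscSeries (f : ℂ → ℂ) (c : ℕ → ℂ) : Prop :=
  ∀ ⦃z : ℂ⦄, ‖z‖ < 1 → HasSum (fun n => c n * z ^ n) (f z)

namespace HasUnitDiscSeries

variable {f g : ℂ → ℂ} {c d e : ℕ → ℂ} {z : ℂ}

lemma eq (hf : HasUnitDiscSeries f c) (hg : HasUnitDiscSeries g c) (hz : ‖z‖ < 1) :
    f z = g z :=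
  (hf hz).unique (hg hz)

lemma congr (hf : HasUnitDiscSeries f c) (hcd : ∀ n, c n = d n) : HasUnitDiscSeries f d :=
  funext hcd ▸ hf

lemma const_mul (hf : HasUnitDiscSeries f c) (κ : ℂ) :
    HasUnitDiscSeries (fun z => κ * f z) fun n => κ * c n := fun z hz => by
  simpa only [mul_assoc] using (hf hz).mul_left κ

lemma sub (hf : HasUnitDiscSeries f c) (hg : HasUnitDiscSeries g d) :
    HasUnitDiscSeries (fun z => f z - g z) fun n => c n - d n := fun z hz => by
  simpa only [sub_mul] using (hf hz).sub (hg hz)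

lemma summable_norm (hf : HasUnitDiscSeries f c) {r : ℝ} (hr : 0 ≤ r) (hr' : r < 1) :
    Summable fun n => ‖c n‖ * r ^ n := by
  simpa [abs_of_nonneg hr] using
    (hf (z := r) (by simpa [abs_of_nonneg hr] using hr')).summable.norm

lemma one_le_radius (hf : HasUnitDiscSeries f c) :
    1 ≤ (FormalMultilinearSeries.ofScalars ℂ c).radius := by
  refine ENNReal.le_of_forall_nnreal_lt fun r hr => ?_
  refine FormalMultilinearSeries.le_radius_of_summable_norm _ ?_
  simpa only [FormalMultilinearSeries.ofScalars_norm] using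
    hf.summable_norm r.coe_nonneg (by exact_mod_cast hr)

lemma hasFPowerSeriesOnBall (hf : HasUnitDiscSeries f c) :
    HasFPowerSeriesOnBall f (FormalMultilinearSeries.ofScalars ℂ c) 0 1 where
  r_le := hf.one_le_radius
  r_pos := one_pos
  hasSum {z} hz := by
    rw [← ENNReal.ofReal_one, Metric.eball_ofReal, mem_ball_zero_iff] at hz
    simpa [FormalMultilinearSeries.ofScalars_apply_eq, mul_comm] using hf hz

lemma differentiableAt (hf : HasUnitDiscSeries f c) (hz : ‖z‖ < 1) : DifferentiableAt ℂ f z := by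
  refine (hf.hasFPowerSeriesOnBall.analyticAt_of_mem ?_).differentiableAt
  simpa [← ENNReal.ofReal_one, Metric.eball_ofReal] using hz

lemma taylorCoeffZero_eq (hf : HasUnitDiscSeries f c) (n : ℕ) : taylorCoeffZero f n = c n := by
  have hp := hf.hasFPowerSeriesOnBall.hasFPowerSeriesAt
  exact congrFun (FormalMultilinearSeries.ofScalars_series_injective ℂ ℂ
    (hp.analyticAt.hasFPowerSeriesAt.eq_formalMultilinearSeries hp)) n

lemma sub_id_mul (hf : HasUnitDiscSeries f c) (hg : HasUnitDiscSeries g d) (h0 : c 0 = e 0)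
    (hsucc : ∀ n, c (n + 1) - d n = e (n + 1)) :
    HasUnitDiscSeries (fun z => f z - z * g z) e := by
  intro z hz
  rw [← hasSum_nat_add_iff' 1]
  have hc := (hasSum_nat_add_iff' 1).2 (hf hz)
  have hd := (hg hz).mul_left z
  convert hc.sub hd using 1
  · funext n
    rw [← hsucc]
    ring
  · simp [h0]
    ring

lemma deriv (hf : HasUnitDiscSeries f c) :
    HasUnitDiscSeries (deriv f) fun n => (n + 1) * c (n + 1) := by
  intro z hz
  have hball : DifferentiableOn ℂ f (Metric.ball 0 1) := fun w hw =>
    (hf.differentiableAt (mem_ball_zero_iff.1 hw)).differentiableWithinAt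
  have hcoeff (n : ℕ) : (n ! : ℂ)⁻¹ * iteratedDeriv n (_root_.deriv f) 0 = (n + 1) * c (n + 1) := by
    have := n.factorial_ne_zero
    rw [← hf.taylorCoeffZero_eq, taylorCoeffZero, ← iteratedDeriv_succ', Nat.factorial_succ]
    push_cast
    field_simp
  simpa only [← hcoeff, sub_zero, smul_eq_mul, mul_right_comm, mul_assoc, mul_comm (z ^ _)] using
    Complex.hasSum_taylorSeries_on_ball (hball.deriv Metric.isOpen_ball) (mem_ball_zero_iff.2 hz)

lemma id_mul_deriv_add (hf : HasUnitDiscSeries f c) (κ : ℂ) :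
    HasUnitDiscSeries (fun z => z * _root_.deriv f z + κ * f z) fun n => (n + κ) * c n := by
  intro z hz
  have hderiv : HasSum (fun n : ℕ => n * c n * z ^ n) (z * _root_.deriv f z) := by
    rw [← hasSum_nat_add_iff' 1]
    simpa [pow_succ', mul_left_comm, mul_assoc] using (hf.deriv hz).mul_left z
  simpa only [add_mul, mul_assoc] using hderiv.add ((hf hz).mul_left κ)

end HasUnitDiscSeries

end UnitDiscSeries

section HypergeometricSeries

open scoped Nat

variable {α β γ z : ℂ}

lemma ordinaryHypergeometric_comm (α β γ : ℂ) : (₂F₁ α β γ : ℂ → ℂ) = ₂F₁ β α γ := by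
  funext z
  rw [ordinaryHypergeometric, ordinaryHypergeometric, ordinaryHypergeometricSeries_symm]

lemma one_le_radius_ordinaryHypergeometricSeries (α β γ : ℂ) :
    1 ≤ (ordinaryHypergeometricSeries ℂ α β γ).radius := by
  by_cases h : ∀ k : ℕ, (k : ℂ) ≠ -α ∧ (k : ℂ) ≠ -β ∧ (k : ℂ) ≠ -γ
  · exact (ordinaryHypergeometricSeries_radius_eq_one ℂ α β γ h).ge
  · obtain ⟨k, hk⟩ := not_forall.1 h
    have htop : (ordinaryHypergeometricSeries ℂ α β γ).radius = ⊤ := by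
      rcases (by tauto : (k : ℂ) = -α ∨ (k : ℂ) = -β ∨ (k : ℂ) = -γ) with h | h | h
      · rw [← neg_neg α, ← h, ordinaryHypergeometric_radius_top_of_neg_nat₁]
      · rw [← neg_neg β, ← h, ordinaryHypergeometric_radius_top_of_neg_nat₂]
      · rw [← neg_neg γ, ← h, ordinaryHypergeometric_radius_top_of_neg_nat₃]
    exact htop ▸ le_top

lemma hasUnitDiscSeries_ordinaryHypergeometric (α β γ : ℂ) :
    HasUnitDiscSeries (₂F₁ α β γ) (ordinaryHypergeometricCoefficient α β γ) := by
  intro z hz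
  have hradius := one_le_radius_ordinaryHypergeometricSeries α β γ
  have hsum := ((ordinaryHypergeometricSeries ℂ α β γ).hasFPowerSeriesOnBall
    (one_pos.trans_le hradius)).hasSum (y := z) (Metric.eball_subset_eball hradius
      (by simpa [← ENNReal.ofReal_one, Metric.eball_ofReal] using hz))
  simpa [ordinaryHypergeometric, ordinaryHypergeometricSeries,
    FormalMultilinearSeries.ofScalars_apply_eq, mul_comm] using hsum

lemma ascPochhammer_eval_ne_zero (hγ : ∀ n : ℕ, γ + n ≠ 0) (n : ℕ) :
    (ascPochhammer ℂ n).eval γ ≠ 0 := by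
  rw [Ne, ascPochhammer_eval_eq_zero_iff]
  rintro ⟨k, -, hk⟩
  exact hγ k (by rw [hk]; ring)

lemma mul_ascPochhammer_eval_add_one (α : ℂ) (n : ℕ) :
    α * (ascPochhammer ℂ n).eval (α + 1) = (ascPochhammer ℂ n).eval α * (α + n) := by
  rw [← ascPochhammer_succ_eval, ascPochhammer_succ_left]
  simp

lemma add_one_add_natCast_ne_zero (hγ : ∀ n : ℕ, γ + n ≠ 0) (n : ℕ) : γ + 1 + n ≠ 0 := by
  have := hγ (n + 1)
  push_cast at this
  rwa [add_assoc, add_comm 1]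

lemma ordinaryHypergeometricCoefficient_succ (hγ : ∀ n : ℕ, γ + n ≠ 0) (n : ℕ) :
    (n + 1) * (γ + n) * ordinaryHypergeometricCoefficient α β γ (n + 1) =
      (α + n) * (β + n) * ordinaryHypergeometricCoefficient α β γ n := by
  have := ascPochhammer_eval_ne_zero hγ n
  have := hγ n
  have := n.cast_add_one_ne_zero (R := ℂ)
  simp only [ordinaryHypergeometricCoefficient, ascPochhammer_succ_eval, Nat.factorial_succ,
    Nat.cast_mul, Nat.cast_add, Nat.cast_one]
  field_simp

lemma ordinaryHypergeometricCoefficient_add_one_left (n : ℕ) :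
    α * ordinaryHypergeometricCoefficient (α + 1) β γ n =
      (α + n) * ordinaryHypergeometricCoefficient α β γ n := by
  simp only [ordinaryHypergeometricCoefficient]
  linear_combination (n ! : ℂ)⁻¹ * (ascPochhammer ℂ n).eval β *
    ((ascPochhammer ℂ n).eval γ)⁻¹ * mul_ascPochhammer_eval_add_one α n

lemma ordinaryHypergeometricCoefficient_add_one_right (hγ : ∀ n : ℕ, γ + n ≠ 0) (n : ℕ) :
    (γ + n) * ordinaryHypergeometricCoefficient α β (γ + 1) n =
      γ * ordinaryHypergeometricCoefficient α β γ n := by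
  have hinv : (γ + n) * ((ascPochhammer ℂ n).eval (γ + 1))⁻¹ =
      γ * ((ascPochhammer ℂ n).eval γ)⁻¹ := by
    have := ascPochhammer_eval_ne_zero hγ n
    have := ascPochhammer_eval_ne_zero (add_one_add_natCast_ne_zero hγ) n
    field_simp
    linear_combination -mul_ascPochhammer_eval_add_one γ n
  simp only [ordinaryHypergeometricCoefficient]
  linear_combination (n ! : ℂ)⁻¹ * (ascPochhammer ℂ n).eval α * (ascPochhammer ℂ n).eval β * hinv

lemma ordinaryHypergeometricCoefficient_succ_eq_add_one_left (hγ : ∀ n : ℕ, γ + n ≠ 0) (n : ℕ) :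
    (n + 1) * (γ + n) * ordinaryHypergeometricCoefficient α β γ (n + 1) =
      α * (β + n) * ordinaryHypergeometricCoefficient (α + 1) β γ n := by
  linear_combination ordinaryHypergeometricCoefficient_succ (α := α) (β := β) hγ n -
    (β + n) * ordinaryHypergeometricCoefficient_add_one_left (α := α) (β := β) (γ := γ) n

lemma ordinaryHypergeometricCoefficient_succ_eq_add_one_left_right
    (hγ : ∀ n : ℕ, γ + n ≠ 0) (n : ℕ) :
    (n + 1) * γ * ordinaryHypergeometricCoefficient α β γ (n + 1) =
      α * (β + n) * ordinaryHypergeometricCoefficient (α + 1) β (γ + 1) n := by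
  refine mul_right_cancel₀ (hγ n) ?_
  linear_combination
    γ * ordinaryHypergeometricCoefficient_succ_eq_add_one_left (α := α) (β := β) hγ n -
    α * (β + n) * ordinaryHypergeometricCoefficient_add_one_right (α := α + 1) (β := β) hγ n

theorem ordinaryHypergeometric_raise_left (hz : ‖z‖ < 1) :
    z * deriv (₂F₁ α β γ) z + α * ₂F₁ α β γ z = α * ₂F₁ (α + 1) β γ z :=
  (((hasUnitDiscSeries_ordinaryHypergeometric α β γ).id_mul_deriv_add α).congr fun n => by
    rw [add_comm, ordinaryHypergeometricCoefficient_add_one_left]).eq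
    ((hasUnitDiscSeries_ordinaryHypergeometric (α + 1) β γ).const_mul α) hz

theorem ordinaryHypergeometric_raise_left_right (hγ : ∀ n : ℕ, γ + n ≠ 0) (hz : ‖z‖ < 1) :
    (1 - z) * deriv (₂F₁ α β γ) z - α * ₂F₁ α β γ z =
      α * (β - γ) / γ * ₂F₁ (α + 1) β (γ + 1) z := by
  have hF := hasUnitDiscSeries_ordinaryHypergeometric α β γ
  have hcoeff (n : ℕ) :
      α * (β - γ) / γ * ordinaryHypergeometricCoefficient (α + 1) β (γ + 1) n =
        (n + 1) * ordinaryHypergeometricCoefficient α β γ (n + 1) -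
          (n + α) * ordinaryHypergeometricCoefficient α β γ n := by
    have hγ₀ : γ ≠ 0 := by simpa using hγ 0
    have hleft := ordinaryHypergeometricCoefficient_add_one_left (α := α) (β := β) (γ := γ) n
    have hright := ordinaryHypergeometricCoefficient_add_one_right (α := α + 1) (β := β) hγ n
    refine mul_right_cancel₀ (hγ n) ?_
    rw [div_mul_eq_mul_div, div_mul_eq_mul_div, div_eq_iff hγ₀]
    linear_combination α * (β - γ) * hright + γ * (β - γ) * hleft -
      γ * ordinaryHypergeometricCoefficient_succ (α := α) (β := β) hγ n
  have hG := (hasUnitDiscSeries_ordinaryHypergeometric (α + 1) β (γ + 1)).const_mul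
    (α * (β - γ) / γ)
  linear_combination (hF.deriv.sub (hF.id_mul_deriv_add α)).eq (hG.congr hcoeff) hz

theorem ordinaryHypergeometric_lower_left (hγ : ∀ n : ℕ, γ + n ≠ 0) (hz : ‖z‖ < 1) :
    z * (1 - z) * deriv (₂F₁ (α + 1) β γ) z + (γ - α - 1 - β * z) * ₂F₁ (α + 1) β γ z =
      (γ - α - 1) * ₂F₁ α β γ z := by
  have hF := hasUnitDiscSeries_ordinaryHypergeometric (α + 1) β γ
  have hG := (hasUnitDiscSeries_ordinaryHypergeometric α β γ).const_mul (γ - α - 1)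
  have hsub := (hF.id_mul_deriv_add (γ - α - 1)).sub_id_mul (hF.id_mul_deriv_add β)
    (e := fun n => (γ - α - 1) * ordinaryHypergeometricCoefficient α β γ n)
    (by simp [ordinaryHypergeometricCoefficient]) fun n => by
      refine mul_left_cancel₀ (mul_ne_zero n.cast_add_one_ne_zero (hγ n)) ?_
      push_cast
      linear_combination (n + γ - α) *
        ordinaryHypergeometricCoefficient_succ (α := α + 1) (β := β) hγ n -
        (γ - α - 1) *
          ordinaryHypergeometricCoefficient_succ_eq_add_one_left (α := α) (β := β) hγ n
  linear_combination hsub.eq hG hz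

theorem ordinaryHypergeometric_lower_left_right (hγ : ∀ n : ℕ, γ + n ≠ 0) (hz : ‖z‖ < 1) :
    z * (1 - z) * deriv (₂F₁ (α + 1) β (γ + 1)) z + (γ - β * z) * ₂F₁ (α + 1) β (γ + 1) z =
      γ * ₂F₁ α β γ z := by
  have hF := hasUnitDiscSeries_ordinaryHypergeometric (α + 1) β (γ + 1)
  have hG := (hasUnitDiscSeries_ordinaryHypergeometric α β γ).const_mul γ
  have hγ' := add_one_add_natCast_ne_zero hγ
  have hsub := (hF.id_mul_deriv_add γ).sub_id_mul (hF.id_mul_deriv_add β)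
    (e := fun n => γ * ordinaryHypergeometricCoefficient α β γ n)
    (by simp [ordinaryHypergeometricCoefficient]) fun n => by
      refine mul_left_cancel₀ (n.cast_add_one_ne_zero (R := ℂ)) ?_
      push_cast
      linear_combination ordinaryHypergeometricCoefficient_succ (α := α + 1) (β := β) hγ' n -
        ordinaryHypergeometricCoefficient_succ_eq_add_one_left_right (α := α) (β := β) hγ n
  linear_combination hsub.eq hG hz

end HypergeometricSeries

section ContiguousPairs

variable {α β γ z : ℂ}

/-- The intersection of the unit discs about `0` and `1`, on which the expansions of hypergeometric
functions about both singular points converge. -/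
def lens : Set ℂ :=
  Metric.ball 0 1 ∩ Metric.ball 1 1

lemma isOpen_lens : IsOpen lens :=
  Metric.isOpen_ball.inter Metric.isOpen_ball

lemma convex_lens : Convex ℝ lens :=
  (convex_ball 0 1).inter (convex_ball 1 1)

lemma norm_lt_one_of_mem_lens (hz : z ∈ lens) : ‖z‖ < 1 :=
  mem_ball_zero_iff.1 hz.1

lemma norm_one_sub_lt_one_of_mem_lens (hz : z ∈ lens) : ‖1 - z‖ < 1 := by
  simpa [dist_eq_norm, norm_sub_rev] using hz.2

lemma one_sub_mem_slitPlane (hz : ‖z‖ < 1) : 1 - z ∈ Complex.slitPlane := by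
  rw [sub_eq_add_neg]
  exact Complex.mem_slitPlane_of_norm_lt_one (by simpa using hz)

lemma mem_slitPlane_of_mem_lens (hz : z ∈ lens) : z ∈ Complex.slitPlane := by
  simpa using one_sub_mem_slitPlane (norm_one_sub_lt_one_of_mem_lens hz)

lemma one_sub_mem_slitPlane_of_mem_lens (hz : z ∈ lens) : 1 - z ∈ Complex.slitPlane :=
  one_sub_mem_slitPlane (norm_lt_one_of_mem_lens hz)

lemma ofReal_mem_lens {x : ℝ} (hx : x ∈ Ioo 0 1) : (x : ℂ) ∈ lens := by
  have hx' : |x - 1| < 1 := abs_sub_lt_iff.2 ⟨by linarith [hx.2], by linarith [hx.1]⟩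
  simpa [lens, abs_of_pos hx.1, hx.2, Complex.dist_eq] using
    (show ‖(x : ℂ) - 1‖ < 1 by exact_mod_cast hx')

/-- `y`, `t` solve on the lens the first order system which the contiguity relations provide for the
functions `₂F₁ α β γ` and `₂F₁ (α + 1) β γ`. It replaces the hypergeometric equation. -/
structure IsContiguousPair (α β γ : ℂ) (y t : ℂ → ℂ) : Prop where
  hasDerivAt_fst : ∀ ⦃z⦄, z ∈ lens → HasDerivAt y (α * (t z - y z) / z) z
  hasDerivAt_snd : ∀ ⦃z⦄, z ∈ lens →
    HasDerivAt t (((γ - α - 1) * (y z - t z) + β * z * t z) / (z * (1 - z))) z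

/-- The solution at `1` of the hypergeometric equation with parameters `α`, `β`, `γ` that is
analytic there. -/
noncomputable def regularSolution (α β γ z : ℂ) : ℂ :=
  ₂F₁ α β (α + β - γ + 1) (1 - z)

/-- The solution at `1` of the hypergeometric equation with parameters `α`, `β`, `γ` that has the
exponent `γ - α - β` there. -/
noncomputable def singularSolution (α β γ z : ℂ) : ℂ :=
  (1 - z) ^ (γ - α - β) * ₂F₁ (γ - α) (γ - β) (γ - α - β + 1) (1 - z)

lemma differentiableAt_ordinaryHypergeometric (hz : ‖z‖ < 1) :
    DifferentiableAt ℂ (₂F₁ α β γ) z :=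
  (hasUnitDiscSeries_ordinaryHypergeometric α β γ).differentiableAt hz

theorem isContiguousPair_ordinaryHypergeometric (hγ : ∀ n : ℕ, γ + n ≠ 0) :
    IsContiguousPair α β γ (₂F₁ α β γ) (₂F₁ (α + 1) β γ) where
  hasDerivAt_fst z hz := by
    have hz₁ := norm_lt_one_of_mem_lens hz
    have hz₀ := Complex.slitPlane_ne_zero (mem_slitPlane_of_mem_lens hz)
    refine (differentiableAt_ordinaryHypergeometric hz₁).hasDerivAt.congr_deriv ?_
    rw [eq_div_iff hz₀]
    linear_combination ordinaryHypergeometric_raise_left (α := α) (β := β) (γ := γ) hz₁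
  hasDerivAt_snd z hz := by
    have hz₁ := norm_lt_one_of_mem_lens hz
    have hz₀ := Complex.slitPlane_ne_zero (mem_slitPlane_of_mem_lens hz)
    have hz₀' := Complex.slitPlane_ne_zero (one_sub_mem_slitPlane_of_mem_lens hz)
    refine (differentiableAt_ordinaryHypergeometric hz₁).hasDerivAt.congr_deriv ?_
    rw [eq_div_iff (mul_ne_zero hz₀ hz₀')]
    linear_combination ordinaryHypergeometric_lower_left (α := α) (β := β) hγ hz₁

theorem isContiguousPair_regularSolution (hδ : ∀ n : ℕ, α + β - γ + 1 + n ≠ 0) :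
    IsContiguousPair α β γ (regularSolution α β γ) fun z =>
      (α - γ + 1) / (α + β - γ + 1) * regularSolution (α + 1) β γ z where
  hasDerivAt_fst z hz := by
    have hz₁ := norm_one_sub_lt_one_of_mem_lens hz
    have hz₀ := Complex.slitPlane_ne_zero (mem_slitPlane_of_mem_lens hz)
    have hδ₀ : α + β - γ + 1 ≠ 0 := by simpa using hδ 0
    have hraise := ordinaryHypergeometric_raise_left_right (α := α) (β := β) hδ hz₁
    refine ((differentiableAt_ordinaryHypergeometric hz₁).hasDerivAt.comp_const_sub 1 z).congr_deriv
      ?_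
    simp only [regularSolution, show α + 1 + β - γ + 1 = α + β - γ + 1 + 1 by ring]
    field_simp at hraise ⊢
    linear_combination -hraise
  hasDerivAt_snd z hz := by
    have hz₁ := norm_one_sub_lt_one_of_mem_lens hz
    have hz₀ := Complex.slitPlane_ne_zero (mem_slitPlane_of_mem_lens hz)
    have hz₀' := Complex.slitPlane_ne_zero (one_sub_mem_slitPlane_of_mem_lens hz)
    have hδ₀ : α + β - γ + 1 ≠ 0 := by simpa using hδ 0
    have hlower := ordinaryHypergeometric_lower_left_right (α := α) (β := β) hδ hz₁
    refine (((differentiableAt_ordinaryHypergeometric hz₁).hasDerivAt.comp_const_sub 1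
      z).const_mul _).congr_deriv ?_
    simp only [regularSolution, show α + 1 + β - γ + 1 = α + β - γ + 1 + 1 by ring]
    field_simp
    linear_combination -(α - γ + 1) * hlower

lemma cpow_eq_mul_cpow_sub_one (hz : z ≠ 0) (s : ℂ) : z ^ s = z * z ^ (s - 1) := by
  rw [Complex.cpow_sub _ _ hz, Complex.cpow_one]
  field_simp

lemma hasDerivAt_one_sub_cpow (hz : 1 - z ∈ Complex.slitPlane) (s : ℂ) :
    HasDerivAt (fun z : ℂ => (1 - z) ^ s) (-(s * (1 - z) ^ (s - 1))) z := by
  simpa using ((hasDerivAt_id z).const_sub 1).cpow_const (c := s) hz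

lemma singularSolution_add_one_left (α β γ : ℂ) :
    singularSolution (α + 1) β γ = fun z =>
      (1 - z) ^ (γ - α - β - 1) * ₂F₁ (γ - α - 1) (γ - β) (γ - α - β) (1 - z) := by
  funext z
  simp only [singularSolution, ← sub_sub, sub_right_comm _ 1 β, sub_add_cancel]

theorem isContiguousPair_singularSolution (hα : α ≠ 0) (hs : ∀ n : ℕ, γ - α - β + n ≠ 0) :
    IsContiguousPair α β γ (singularSolution α β γ) fun z =>
      -((γ - α - β) / α) * singularSolution (α + 1) β γ z where
  hasDerivAt_fst z hz := by
    have hz₁ := norm_one_sub_lt_one_of_mem_lens hz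
    have hslit := one_sub_mem_slitPlane_of_mem_lens hz
    have hz₀ := Complex.slitPlane_ne_zero (mem_slitPlane_of_mem_lens hz)
    have hpow := cpow_eq_mul_cpow_sub_one (Complex.slitPlane_ne_zero hslit) (γ - α - β)
    have hlower := ordinaryHypergeometric_lower_left_right (α := γ - α - 1) (β := γ - β) hs hz₁
    rw [sub_add_cancel] at hlower
    rw [singularSolution_add_one_left]
    refine ((hasDerivAt_one_sub_cpow hslit _).mul
      ((differentiableAt_ordinaryHypergeometric hz₁).hasDerivAt.comp_const_sub 1 z)).congr_deriv ?_
    simp only [singularSolution, hpow]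
    field_simp
    linear_combination -(1 - z) ^ (γ - α - β - 1) * hlower
  hasDerivAt_snd z hz := by
    have hz₁ := norm_one_sub_lt_one_of_mem_lens hz
    have hslit := one_sub_mem_slitPlane_of_mem_lens hz
    have hz₀ := Complex.slitPlane_ne_zero (mem_slitPlane_of_mem_lens hz)
    have hz₀' := Complex.slitPlane_ne_zero hslit
    have hs₀ : γ - α - β ≠ 0 := by simpa using hs 0
    have hpow := cpow_eq_mul_cpow_sub_one hz₀' (γ - α - β)
    have hpow' := cpow_eq_mul_cpow_sub_one hz₀' (γ - α - β - 1)
    have hraise := ordinaryHypergeometric_raise_left_right (α := γ - α - 1) (β := γ - β) hs hz₁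
    rw [sub_add_cancel] at hraise
    rw [singularSolution_add_one_left]
    refine (((hasDerivAt_one_sub_cpow hslit _).mul
      ((differentiableAt_ordinaryHypergeometric hz₁).hasDerivAt.comp_const_sub 1 z)).const_mul
        _).congr_deriv ?_
    simp only [singularSolution, hpow, hpow']
    field_simp at hraise ⊢
    linear_combination (1 - z) ^ (γ - α - β - 1 - 1) * (1 - z) * hraise

namespace IsContiguousPair

variable {y₁ t₁ y₂ t₂ : ℂ → ℂ}

lemma linearCombination (h₁ : IsContiguousPair α β γ y₁ t₁) (h₂ : IsContiguousPair α β γ y₂ t₂)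
    (A B : ℂ) :
    IsContiguousPair α β γ (fun z => A * y₁ z + B * y₂ z) fun z => A * t₁ z + B * t₂ z where
  hasDerivAt_fst z hz :=
    (((h₁.hasDerivAt_fst hz).const_mul A).add ((h₂.hasDerivAt_fst hz).const_mul B)).congr_deriv
      (by ring)
  hasDerivAt_snd z hz :=
    (((h₁.hasDerivAt_snd hz).const_mul A).add ((h₂.hasDerivAt_snd hz).const_mul B)).congr_deriv
      (by ring)

lemma eqOn_snd (hα : α ≠ 0) (h₁ : IsContiguousPair α β γ y₁ t₁)
    (h₂ : IsContiguousPair α β γ y₂ t₂) (hy : EqOn y₁ y₂ lens) : EqOn t₁ t₂ lens := by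
  intro z hz
  have hz₀ := Complex.slitPlane_ne_zero (mem_slitPlane_of_mem_lens hz)
  have hderiv := (h₁.hasDerivAt_fst hz).unique
    ((h₂.hasDerivAt_fst hz).congr_of_eventuallyEq
      (hy.eventuallyEq_of_mem (isOpen_lens.mem_nhds hz)))
  rw [hy hz] at hderiv
  field_simp at hderiv
  exact sub_left_injective hderiv

lemma eqOn_fst (hγα : γ - α - 1 ≠ 0) (h₁ : IsContiguousPair α β γ y₁ t₁)
    (h₂ : IsContiguousPair α β γ y₂ t₂) (ht : EqOn t₁ t₂ lens) : EqOn y₁ y₂ lens := by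
  intro z hz
  have hz₀ := Complex.slitPlane_ne_zero (mem_slitPlane_of_mem_lens hz)
  have hz₀' := Complex.slitPlane_ne_zero (one_sub_mem_slitPlane_of_mem_lens hz)
  have hderiv := (h₁.hasDerivAt_snd hz).unique
    ((h₂.hasDerivAt_snd hz).congr_of_eventuallyEq
      (ht.eventuallyEq_of_mem (isOpen_lens.mem_nhds hz)))
  rw [ht hz, div_left_inj' (mul_ne_zero hz₀ hz₀')] at hderiv
  refine mul_left_cancel₀ hγα ?_
  linear_combination hderiv

end IsContiguousPair

/-- The discrete analogue of the Wronskian of two contiguous pairs, multiplied by the integrating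
factor that makes it constant. -/
noncomputable def casoratian (α β γ : ℂ) (y₁ t₁ y₂ t₂ : ℂ → ℂ) (z : ℂ) : ℂ :=
  z ^ (γ - 1) * (1 - z) ^ (α + β - γ + 1) * (y₁ z * t₂ z - t₁ z * y₂ z)

namespace IsContiguousPair

variable {y₁ t₁ y₂ t₂ : ℂ → ℂ}

lemma hasDerivAt_casoratian (h₁ : IsContiguousPair α β γ y₁ t₁)
    (h₂ : IsContiguousPair α β γ y₂ t₂) (hz : z ∈ lens) :
    HasDerivAt (casoratian α β γ y₁ t₁ y₂ t₂) 0 z := by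
  have hslit := mem_slitPlane_of_mem_lens hz
  have hslit' := one_sub_mem_slitPlane_of_mem_lens hz
  have hz₀ := Complex.slitPlane_ne_zero hslit
  have hz₀' := Complex.slitPlane_ne_zero hslit'
  refine ((((hasDerivAt_id z).cpow_const (c := γ - 1) hslit).mul
    (hasDerivAt_one_sub_cpow hslit' (α + β - γ + 1))).mul
    (((h₁.hasDerivAt_fst hz).mul (h₂.hasDerivAt_snd hz)).sub
      ((h₁.hasDerivAt_snd hz).mul (h₂.hasDerivAt_fst hz)))).congr_deriv ?_
  simp only [Pi.mul_apply, Pi.sub_apply, id_eq, cpow_eq_mul_cpow_sub_one hz₀ (γ - 1),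
    cpow_eq_mul_cpow_sub_one hz₀' (α + β - γ + 1)]
  field_simp
  ring

lemma casoratian_eq (h₁ : IsContiguousPair α β γ y₁ t₁) (h₂ : IsContiguousPair α β γ y₂ t₂)
    {w : ℂ} (hz : z ∈ lens) (hw : w ∈ lens) :
    casoratian α β γ y₁ t₁ y₂ t₂ z = casoratian α β γ y₁ t₁ y₂ t₂ w := by
  refine isOpen_lens.is_const_of_deriv_eq_zero convex_lens.isPreconnected (fun z hz => ?_)
    (fun z hz => ?_) hz hw
  · exact (h₁.hasDerivAt_casoratian h₂ hz).differentiableAt.differentiableWithinAt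
  · exact (h₁.hasDerivAt_casoratian h₂ hz).deriv

end IsContiguousPair

/-- The behaviour at `1` that identifies a contiguous pair: `y` tends to `u` and
`(1 - x) ^ (1 - s) * t x` tends to `v` as `x` tends to `1` from the left. -/
structure HasBoundaryValues (s : ℂ) (y t : ℂ → ℂ) (u v : ℂ) : Prop where
  tendsto_fst : Tendsto (fun x : ℝ => y x) (𝓝[<] 1) (𝓝 u)
  tendsto_snd : Tendsto (fun x : ℝ => (1 - x : ℂ) ^ (1 - s) * t x) (𝓝[<] 1) (𝓝 v)

lemma HasBoundaryValues.linearCombination {s u₁ v₁ u₂ v₂ : ℂ} {y₁ t₁ y₂ t₂ : ℂ → ℂ}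
    (h₁ : HasBoundaryValues s y₁ t₁ u₁ v₁) (h₂ : HasBoundaryValues s y₂ t₂ u₂ v₂) (A B : ℂ) :
    HasBoundaryValues s (fun z => A * y₁ z + B * y₂ z) (fun z => A * t₁ z + B * t₂ z)
      (A * u₁ + B * u₂) (A * v₁ + B * v₂) where
  tendsto_fst := (h₁.tendsto_fst.const_mul A).add (h₂.tendsto_fst.const_mul B)
  tendsto_snd := ((h₁.tendsto_snd.const_mul A).add (h₂.tendsto_snd.const_mul B)).congr
    fun x => by ring

lemma tendsto_one_sub_ofReal :
    Tendsto (fun x : ℝ => 1 - (x : ℂ)) (𝓝[<] 1) (𝓝 0) :=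
  tendsto_nhdsWithin_of_tendsto_nhds (Continuous.tendsto' (by fun_prop) _ _ (by simp))

lemma tendsto_one_sub_ofReal_cpow {s : ℂ} (hs : 0 < s.re) :
    Tendsto (fun x : ℝ => (1 - (x : ℂ)) ^ s) (𝓝[<] 1) (𝓝 0) := by
  have hs₀ : s ≠ 0 := fun h => by simp [h] at hs
  have hcont := (Complex.continuousAt_cpow_const_of_re_pos (z := 0) (by simp) hs).tendsto
  rw [Complex.zero_cpow hs₀] at hcont
  exact hcont.comp tendsto_one_sub_ofReal

lemma tendsto_ordinaryHypergeometric_one_sub_ofReal (α β γ : ℂ) :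
    Tendsto (fun x : ℝ => ₂F₁ α β γ (1 - (x : ℂ))) (𝓝[<] 1) (𝓝 1) := by
  have hcont := (differentiableAt_ordinaryHypergeometric (α := α) (β := β) (γ := γ)
    (z := 0) (by simp)).continuousAt.tendsto
  rw [ordinaryHypergeometric_zero] at hcont
  exact hcont.comp tendsto_one_sub_ofReal

lemma hasBoundaryValues_regularSolution (hs : (γ - α - β).re < 1) (κ : ℂ) :
    HasBoundaryValues (γ - α - β) (regularSolution α β γ)
      (fun z => κ * regularSolution (α + 1) β γ z) 1 0 where
  tendsto_fst := tendsto_ordinaryHypergeometric_one_sub_ofReal _ _ _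
  tendsto_snd := by
    simpa [regularSolution] using (tendsto_one_sub_ofReal_cpow (s := 1 - (γ - α - β))
      (by simpa using hs)).mul
        ((tendsto_ordinaryHypergeometric_one_sub_ofReal _ _ _).const_mul κ)

lemma hasBoundaryValues_singularSolution (hs : 0 < (γ - α - β).re) (κ : ℂ) :
    HasBoundaryValues (γ - α - β) (singularSolution α β γ)
      (fun z => κ * singularSolution (α + 1) β γ z) 0 κ where
  tendsto_fst := by
    simpa [singularSolution] using (tendsto_one_sub_ofReal_cpow hs).mul
      (tendsto_ordinaryHypergeometric_one_sub_ofReal _ _ _)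
  tendsto_snd := by
    rw [singularSolution_add_one_left]
    have hF := (tendsto_ordinaryHypergeometric_one_sub_ofReal (γ - α - 1) (γ - β)
      (γ - α - β)).const_mul κ
    rw [mul_one] at hF
    refine hF.congr' (eventually_nhdsWithin_of_forall fun x (hx : x < 1) => ?_)
    have hx₀ : (1 - x : ℂ) ≠ 0 := by exact_mod_cast (sub_pos.2 hx).ne'
    have hcancel : (1 - x : ℂ) ^ (1 - (γ - α - β)) * (1 - x : ℂ) ^ (γ - α - β - 1) = 1 := by
      rw [← Complex.cpow_add _ _ hx₀]
      simp
    linear_combination -κ * ₂F₁ (γ - α - 1) (γ - β) (γ - α - β) (1 - x : ℂ) * hcancel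

namespace IsContiguousPair

variable {y₁ t₁ y₂ t₂ : ℂ → ℂ} {u v u₁ v₁ u₂ v₂ : ℂ}

lemma casoratian_eq_boundaryValues (h₁ : IsContiguousPair α β γ y₁ t₁)
    (h₂ : IsContiguousPair α β γ y₂ t₂) (hb₁ : HasBoundaryValues (γ - α - β) y₁ t₁ u₁ v₁)
    (hb₂ : HasBoundaryValues (γ - α - β) y₂ t₂ u₂ v₂) (hz : z ∈ lens) :
    casoratian α β γ y₁ t₁ y₂ t₂ z = u₁ * v₂ - v₁ * u₂ := by
  have hpow : Tendsto (fun x : ℝ => (x : ℂ) ^ (γ - 1)) (𝓝[<] 1) (𝓝 1) := by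
    have hcont : ContinuousAt (fun x : ℝ => (x : ℂ) ^ (γ - 1)) 1 :=
      (continuousAt_cpow_const (by simp)).comp Complex.continuous_ofReal.continuousAt
    simpa using hcont.tendsto.mono_left nhdsWithin_le_nhds
  have hlim := hpow.mul ((hb₁.tendsto_fst.mul hb₂.tendsto_snd).sub
    (hb₁.tendsto_snd.mul hb₂.tendsto_fst))
  rw [one_mul] at hlim
  refine tendsto_nhds_unique (tendsto_const_nhds.congr' ?_) hlim
  filter_upwards [Ioo_mem_nhdsLT one_pos] with x hx
  rw [h₁.casoratian_eq h₂ hz (ofReal_mem_lens hx), casoratian,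
    show α + β - γ + 1 = 1 - (γ - α - β) by ring]
  ring

/-- Both pairs have the same Casoratians with the two local solutions at `1`, which are independent
of each other. -/
theorem eqOn_of_boundaryValues (hα : α ≠ 0) (hδ : ∀ n : ℕ, α + β - γ + 1 + n ≠ 0)
    (hs : ∀ n : ℕ, γ - α - β + n ≠ 0) (hs₀ : 0 < (γ - α - β).re) (hs₁ : (γ - α - β).re < 1)
    (h₁ : IsContiguousPair α β γ y₁ t₁) (h₂ : IsContiguousPair α β γ y₂ t₂)
    (hb₁ : HasBoundaryValues (γ - α - β) y₁ t₁ u v)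
    (hb₂ : HasBoundaryValues (γ - α - β) y₂ t₂ u v) : EqOn y₁ y₂ lens := by
  intro z hz
  have hR := isContiguousPair_regularSolution hδ
  have hS := isContiguousPair_singularSolution hα hs
  have hbR := hasBoundaryValues_regularSolution hs₁ ((α - γ + 1) / (α + β - γ + 1))
  have hbS := hasBoundaryValues_singularSolution hs₀ (-((γ - α - β) / α))
  have heqR := (h₁.casoratian_eq_boundaryValues hR hb₁ hbR hz).trans
    (h₂.casoratian_eq_boundaryValues hR hb₂ hbR hz).symm
  have heqS := (h₁.casoratian_eq_boundaryValues hS hb₁ hbS hz).trans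
    (h₂.casoratian_eq_boundaryValues hS hb₂ hbS hz).symm
  have hRS := hR.casoratian_eq_boundaryValues hS hbR hbS hz
  have hne : (1 : ℂ) * -((γ - α - β) / α) - 0 * 0 ≠ 0 := by
    rw [one_mul, zero_mul, sub_zero]
    exact neg_ne_zero.2 (div_ne_zero (by simpa using hs 0) hα)
  rw [← hRS] at hne
  refine mul_right_cancel₀ hne ?_
  simp only [casoratian] at heqR heqS ⊢
  linear_combination regularSolution α β γ z * heqS - singularSolution α β γ z * heqR

end IsContiguousPair

end ContiguousPairs

section EulerIntegral

open MeasureTheory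

variable {α u v z : ℂ} {t : ℝ}

lemma hasUnitDiscSeries_one_sub_cpow (s : ℂ) :
    HasUnitDiscSeries (fun z => (1 - z) ^ s) (ordinaryHypergeometricCoefficient (-s) 1 1) := by
  intro z hz
  have hsum := Complex.one_add_cpow_hasFPowerSeriesOnBall_zero (a := s) |>.hasSum (y := -z)
    (by rw [← ENNReal.ofReal_one, Metric.eball_ofReal]; simpa using hz)
  rw [binomialSeries_eq_ordinaryHypergeometricSeries (b := 1)
    (fun k h => Nat.cast_add_one_ne_zero k (by linear_combination h)), zero_add,
    ← sub_eq_add_neg] at hsum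
  refine hsum.congr_fun fun n => ?_
  have hneg : ⇑(-(ContinuousLinearMap.id ℂ ℂ)) ∘ (fun _ : Fin n => -z) = fun _ => z := by
    funext
    simp
  rw [FormalMultilinearSeries.compContinuousLinearMap_apply, hneg, ordinaryHypergeometricSeries,
    FormalMultilinearSeries.ofScalars_apply_eq, smul_eq_mul]

/-- The integrand of the beta integral. -/
noncomputable def betaKernel (u v : ℂ) (t : ℝ) : ℂ :=
  (t : ℂ) ^ (u - 1) * (1 - (t : ℂ)) ^ (v - 1)

lemma integrableOn_betaKernel (hu : 0 < u.re) (hv : 0 < v.re) :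
    IntegrableOn (betaKernel u v) (Ioo 0 1) :=
  (intervalIntegrable_iff_integrableOn_Ioo_of_le zero_le_one).1
    (Complex.betaIntegral_convergent hu hv)

lemma integral_betaKernel (u v : ℂ) :
    ∫ t in Ioo 0 1, betaKernel u v t = Complex.betaIntegral u v := by
  rw [Complex.betaIntegral, intervalIntegral.integral_of_le zero_le_one,
    integral_Ioc_eq_integral_Ioo]
  rfl

lemma betaKernel_mul_pow (ht : 0 < t) (n : ℕ) :
    betaKernel u v t * (t : ℂ) ^ n = betaKernel (u + n) v t := by
  rw [betaKernel, betaKernel, add_sub_right_comm, Complex.cpow_add _ _ (by exact_mod_cast ht.ne'),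
    Complex.cpow_natCast]
  ring

lemma betaKernel_mul_cpow (ht : t < 1) (s : ℂ) :
    betaKernel u v t * (1 - (t : ℂ)) ^ s = betaKernel u (v + s) t := by
  have ht₀ : (1 - t : ℂ) ≠ 0 := by exact_mod_cast (sub_pos.2 ht).ne'
  rw [betaKernel, betaKernel, add_sub_right_comm, Complex.cpow_add _ _ ht₀, mul_assoc]

lemma add_natCast_ne_zero_of_re_pos (hu : 0 < u.re) (n : ℕ) : u + n ≠ 0 := fun h => by
  have := congrArg Complex.re h
  simp only [Complex.add_re, Complex.natCast_re, Complex.zero_re] at this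
  linarith [n.cast_nonneg (α := ℝ)]

lemma Gamma_add_natCast (hu : ∀ n : ℕ, u + n ≠ 0) (n : ℕ) :
    Complex.Gamma (u + n) = (ascPochhammer ℂ n).eval u * Complex.Gamma u := by
  have hu' (k : ℕ) : u ≠ -k := fun h => hu k (by simp [h])
  rw [← Complex.Gamma_add_nat_div_Gamma_eq u hu', div_mul_cancel₀ _ (Complex.Gamma_ne_zero hu')]

lemma betaIntegral_ne_zero (hu : 0 < u.re) (hv : 0 < v.re) : Complex.betaIntegral u v ≠ 0 := by
  have huv : 0 < (u + v).re := add_pos hu hv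
  rw [Complex.betaIntegral_eq_Gamma_mul_div _ _ hu hv]
  exact div_ne_zero (mul_ne_zero (Complex.Gamma_ne_zero_of_re_pos hu)
    (Complex.Gamma_ne_zero_of_re_pos hv)) (Complex.Gamma_ne_zero_of_re_pos huv)

lemma betaIntegral_add_natCast (hu : 0 < u.re) (hv : 0 < v.re) (n : ℕ) :
    Complex.betaIntegral (u + n) v =
      (ascPochhammer ℂ n).eval u / (ascPochhammer ℂ n).eval (u + v) * Complex.betaIntegral u v := by
  have huv : 0 < (u + v).re := add_pos hu hv
  rw [Complex.betaIntegral_eq_Gamma_mul_div _ _ (by simpa using by positivity) hv,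
    Complex.betaIntegral_eq_Gamma_mul_div _ _ hu hv, add_right_comm,
    Gamma_add_natCast (add_natCast_ne_zero_of_re_pos hu),
    Gamma_add_natCast (add_natCast_ne_zero_of_re_pos huv)]
  ring

/-- Euler's integral for `₂F₁ α u (u + v) z`, without its normalising factor. -/
noncomputable def eulerIntegral (α u v z : ℂ) : ℂ :=
  ∫ t in Ioo (0 : ℝ) 1, betaKernel u v t * (1 - t * z) ^ (-α)

lemma HasUnitDiscSeries.hasSum_integral {f : ℂ → ℂ} {c : ℕ → ℂ} (hf : HasUnitDiscSeries f c)
    {k : ℝ → ℂ} (hk : IntegrableOn k (Ioo 0 1)) (hz : ‖z‖ < 1) :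
    HasSum (fun n => ∫ t in Ioo (0 : ℝ) 1, k t * (c n * (t * z) ^ n))
      (∫ t in Ioo (0 : ℝ) 1, k t * f (t * z)) := by
  refine hasSum_integral_of_dominated_convergence (fun n t => ‖k t‖ * (‖c n‖ * ‖z‖ ^ n))
    (fun n => hk.aestronglyMeasurable.mul (Continuous.aestronglyMeasurable (by fun_prop))) ?_
    (ae_of_all _ fun t => (hf.summable_norm (norm_nonneg z) hz).mul_left _) ?_ ?_
  · intro n
    filter_upwards [ae_restrict_mem measurableSet_Ioo] with t ht
    rw [norm_mul, norm_mul, norm_pow, norm_mul, Complex.norm_real, Real.norm_of_nonneg ht.1.le]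
    have ht₀ := ht.1.le
    gcongr
    exact mul_le_of_le_one_left (norm_nonneg z) ht.2.le
  · simp only [tsum_mul_left]
    exact hk.norm.mul_const _
  · filter_upwards [ae_restrict_mem measurableSet_Ioo] with t ht
    refine (hf ?_).mul_left _
    rw [norm_mul, Complex.norm_real, Real.norm_of_nonneg ht.1.le]
    exact (mul_le_of_le_one_left (norm_nonneg z) ht.2.le).trans_lt hz

theorem eulerIntegral_eq (hu : 0 < u.re) (hv : 0 < v.re) (hz : ‖z‖ < 1) :
    eulerIntegral α u v z = Complex.betaIntegral u v * ₂F₁ α u (u + v) z := by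
  have hpow := hasUnitDiscSeries_one_sub_cpow (-α)
  rw [neg_neg] at hpow
  refine (hpow.hasSum_integral (integrableOn_betaKernel hu hv) hz).unique
    (((hasUnitDiscSeries_ordinaryHypergeometric _ _ _ hz).mul_left _).congr_fun fun n => ?_)
  have hshift : EqOn
      (fun t : ℝ => betaKernel u v t * (ordinaryHypergeometricCoefficient α 1 1 n * (t * z) ^ n))
      (fun t => betaKernel (u + n) v t * (ordinaryHypergeometricCoefficient α 1 1 n * z ^ n))
      (Ioo 0 1) := fun t ht => by
    simp only [← betaKernel_mul_pow ht.1]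
    ring
  have := n.factorial_ne_zero
  rw [setIntegral_congr_fun measurableSet_Ioo hshift, integral_mul_const, integral_betaKernel,
    betaIntegral_add_natCast hu hv]
  simp only [ordinaryHypergeometricCoefficient, ascPochhammer_eval_one]
  field_simp

lemma norm_one_sub_mul_ofReal_cpow_le (s : ℂ) {x : ℝ} (hx : x ∈ Ioo 0 1) (ht : t ∈ Ioo 0 1) :
    ‖(1 - t * x : ℂ) ^ s‖ ≤ 1 + ‖(1 - t : ℂ) ^ s‖ := by
  have ht₁ : 0 < 1 - t := sub_pos.2 ht.2
  have hle : 1 - t ≤ 1 - t * x := by nlinarith [ht.1, hx.2]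
  have hle' : 1 - t * x ≤ 1 := by nlinarith [ht.1, hx.1]
  have hnorm (r : ℝ) (hr : 0 < r) : ‖(r : ℂ) ^ s‖ = r ^ s.re :=
    Complex.norm_cpow_eq_rpow_re_of_pos hr s
  have h₁ := hnorm _ ht₁
  have h₂ := hnorm _ (ht₁.trans_le hle)
  push_cast at h₁ h₂
  rw [h₁, h₂]
  rcases le_total 0 s.re with hs | hs
  · exact (Real.rpow_le_one (ht₁.le.trans hle) hle' hs).trans
      (le_add_of_nonneg_right (Real.rpow_nonneg ht₁.le _))
  · exact (Real.rpow_le_rpow_of_nonpos ht₁ hle hs).trans (le_add_of_nonneg_left zero_le_one)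

lemma tendsto_eulerIntegral (hu : 0 < u.re) (hv : 0 < v.re) (hvα : 0 < (v - α).re) :
    Tendsto (fun x : ℝ => eulerIntegral α u v x) (𝓝[<] 1) (𝓝 (Complex.betaIntegral u (v - α))) := by
  have hkernel := integrableOn_betaKernel hu hv
  have hslit {x t : ℝ} (hx : x ≤ 1) (ht : t ∈ Ioo 0 1) : (1 - t * x : ℂ) ∈ Complex.slitPlane := by
    have : (0 : ℝ) < 1 - t * x := by nlinarith [ht.1, ht.2]
    exact_mod_cast Complex.ofReal_mem_slitPlane.2 this
  have hcont {x : ℝ} (hx : x ≤ 1) :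
      ContinuousOn (fun t : ℝ => (1 - t * x : ℂ) ^ (-α)) (Ioo 0 1) :=
    ContinuousOn.cpow_const (by fun_prop) fun t ht => hslit hx ht
  rw [← integral_betaKernel]
  refine tendsto_integral_filter_of_dominated_convergence
    (fun t => ‖betaKernel u v t‖ + ‖betaKernel u (v - α) t‖) ?_ ?_ ?_ ?_
  · filter_upwards [self_mem_nhdsWithin] with x hx
    exact hkernel.aestronglyMeasurable.mul
      ((hcont (le_of_lt hx)).aestronglyMeasurable measurableSet_Ioo)
  · filter_upwards [Ioo_mem_nhdsLT one_pos] with x hx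
    filter_upwards [ae_restrict_mem measurableSet_Ioo] with t ht
    rw [norm_mul, sub_eq_add_neg v, ← betaKernel_mul_cpow ht.2, norm_mul, ← mul_one_add]
    gcongr
    exact norm_one_sub_mul_ofReal_cpow_le _ hx ht
  · exact hkernel.norm.add (integrableOn_betaKernel hu hvα).norm
  · filter_upwards [ae_restrict_mem measurableSet_Ioo] with t ht
    rw [sub_eq_add_neg v, ← betaKernel_mul_cpow ht.2]
    have hlim : ContinuousAt (fun x : ℝ => (1 - t * x : ℂ) ^ (-α)) 1 :=
      ContinuousAt.cpow (by fun_prop) continuousAt_const (by simpa using hslit le_rfl ht)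
    simpa using (hlim.tendsto.mono_left nhdsWithin_le_nhds).const_mul (betaKernel u v t)

theorem tendsto_ordinaryHypergeometric_one {β γ : ℂ} (hβ : 0 < β.re) (hγβ : 0 < (γ - β).re)
    (hs : 0 < (γ - α - β).re) :
    Tendsto (fun x : ℝ => ₂F₁ α β γ (x : ℂ)) (𝓝[<] 1)
      (𝓝 (Complex.Gamma γ * Complex.Gamma (γ - α - β) /
        (Complex.Gamma (γ - α) * Complex.Gamma (γ - β)))) := by
  have hs' : 0 < (γ - β - α).re := by rwa [sub_right_comm]
  have hbeta := Complex.betaIntegral_eq_Gamma_mul_div β (γ - β) hβ hγβ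
  have hlim := (tendsto_eulerIntegral hβ hγβ hs').div_const (Complex.betaIntegral β (γ - β))
  convert hlim.congr' ?_ using 2
  · rw [hbeta, Complex.betaIntegral_eq_Gamma_mul_div _ _ hβ hs', add_sub_cancel,
      show β + (γ - β - α) = γ - α by ring, sub_right_comm γ α β]
    have := Complex.Gamma_ne_zero_of_re_pos hβ
    field_simp
  · filter_upwards [Ioo_mem_nhdsLT one_pos] with x hx
    rw [eulerIntegral_eq hβ hγβ (norm_lt_one_of_mem_lens (ofReal_mem_lens hx)), add_sub_cancel,
      mul_div_cancel_left₀ _ (betaIntegral_ne_zero hβ hγβ)]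

end EulerIntegral

section SingularityAtOne

open Asymptotics
open scoped Nat

variable {α β γ δ : ℂ}

/-- An Abelian theorem: on approach to `1` within the reals, coefficientwise negligibility against a
nonnegative sequence is inherited by the sums. -/
theorem HasUnitDiscSeries.isLittleO {f g : ℂ → ℂ} {c : ℕ → ℂ} {d : ℕ → ℝ}
    (hf : HasUnitDiscSeries f c) (hg : HasUnitDiscSeries g fun n => (d n : ℂ)) (hd : ∀ n, 0 ≤ d n)
    (hcd : c =o[atTop] d) (hg_top : Tendsto (fun x : ℝ => ‖g x‖) (𝓝[<] 1) atTop) :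
    (fun x : ℝ => f x) =o[𝓝[<] 1] fun x : ℝ => g x := by
  refine isLittleO_iff.2 fun ε hε => ?_
  obtain ⟨N, hN⟩ := eventually_atTop.1 (isLittleO_iff.1 hcd (half_pos hε))
  set head : ℕ → ℝ := (Finset.range N : Set ℕ).indicator fun n => ‖c n‖ with hhead
  have hhead_nonneg (n : ℕ) : 0 ≤ head n := indicator_nonneg (fun _ _ => norm_nonneg _) n
  have hhead_sum : HasSum head (∑ n ∈ Finset.range N, head n) :=
    hasSum_sum_of_ne_finset_zero fun n hn => indicator_of_notMem (by simpa using hn) _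
  filter_upwards [hg_top.eventually_ge_atTop ((∑ n ∈ Finset.range N, head n) / (ε / 2)),
    Ioo_mem_nhdsLT one_pos] with x hgx hx
  have hx₁ : ‖(x : ℂ)‖ < 1 := norm_lt_one_of_mem_lens (ofReal_mem_lens hx)
  have hdx : HasSum (fun n => d n * x ^ n) (g x).re :=
    ((Complex.hasSum_iff _ _).1 (hg hx₁)).1.congr_fun fun n => by
      rw [← Complex.ofReal_pow, ← Complex.ofReal_mul, Complex.ofReal_re]
  have hbound (n : ℕ) : ‖c n * (x : ℂ) ^ n‖ ≤ head n + ε / 2 * (d n * x ^ n) := by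
    have hxn := pow_nonneg hx.1.le n
    rw [norm_mul, norm_pow, Complex.norm_real, Real.norm_of_nonneg hx.1.le]
    rcases lt_or_ge n N with hn | hn
    · rw [hhead, indicator_of_mem (by simpa using hn)]
      exact (mul_le_of_le_one_right (norm_nonneg _) (pow_le_one₀ hx.1.le hx.2.le)).trans
        (le_add_of_nonneg_right (mul_nonneg (half_pos hε).le (mul_nonneg (hd n) hxn)))
    · have hcn := hN n hn
      rw [Real.norm_of_nonneg (hd n)] at hcn
      calc ‖c n‖ * x ^ n ≤ ε / 2 * d n * x ^ n := by gcongr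
        _ ≤ head n + ε / 2 * (d n * x ^ n) := by linarith [hhead_nonneg n]
  calc ‖f x‖ ≤ ∑ n ∈ Finset.range N, head n + ε / 2 * (g x).re :=
        (hf hx₁).tsum_eq ▸ tsum_of_norm_bounded (hhead_sum.add (hdx.mul_left _)) hbound
    _ ≤ ε / 2 * ‖g x‖ + ε / 2 * ‖g x‖ := by
        gcongr
        · rwa [div_le_iff₀' (half_pos hε)] at hgx
        · exact Complex.re_le_norm _
    _ = ε * ‖g x‖ := by ring

lemma ascPochhammer_eval_eq_prod (s : ℂ) (n : ℕ) :
    (ascPochhammer ℂ n).eval s = ∏ i ∈ Finset.range n, (s + i) := by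
  induction n with
  | zero => simp
  | succ n ih => rw [ascPochhammer_succ_eval, Finset.prod_range_succ, ih]

lemma ofReal_rising (x : ℝ) (n : ℕ) : (rising x n : ℂ) = (ascPochhammer ℂ n).eval (x : ℂ) := by
  simp [rising, ascPochhammer_eval_eq_prod]

lemma tendsto_ascPochhammer_mul_div_mul (hα : ∀ n : ℕ, α + n ≠ 0) (hβ : ∀ n : ℕ, β + n ≠ 0)
    (h : α + β = γ + δ) :
    Tendsto (fun n => (ascPochhammer ℂ n).eval α * (ascPochhammer ℂ n).eval β /
        ((ascPochhammer ℂ n).eval γ * (ascPochhammer ℂ n).eval δ)) atTop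
      (𝓝 (Complex.Gamma γ * Complex.Gamma δ / (Complex.Gamma α * Complex.Gamma β))) := by
  have hGamma {s : ℂ} (hs : ∀ n : ℕ, s + n ≠ 0) : Complex.Gamma s ≠ 0 :=
    Complex.Gamma_ne_zero fun n hn => hs n (by simp [hn])
  have hlim := ((Complex.GammaSeq_tendsto_Gamma γ).mul (Complex.GammaSeq_tendsto_Gamma δ)).div
    ((Complex.GammaSeq_tendsto_Gamma α).mul (Complex.GammaSeq_tendsto_Gamma β))
    (mul_ne_zero (hGamma hα) (hGamma hβ))
  rw [← tendsto_add_atTop_iff_nat 1]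
  refine hlim.congr' ?_
  filter_upwards [eventually_ne_atTop 0] with n hn
  have hn₀ : (n : ℂ) ≠ 0 := Nat.cast_ne_zero.2 hn
  have hpow : (n : ℂ) ^ γ * n ^ δ = n ^ α * n ^ β := by
    rw [← Complex.cpow_add _ _ hn₀, ← Complex.cpow_add _ _ hn₀, h]
  have hpow₀ : (n : ℂ) ^ α * n ^ β * (n ! * n !) ≠ 0 := by
    simp [Complex.cpow_eq_zero_iff, hn₀, n.factorial_ne_zero]
  simp only [Pi.div_apply, Complex.GammaSeq, ← ascPochhammer_eval_eq_prod, div_mul_div_comm,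
    mul_mul_mul_comm _ (n ! : ℂ), hpow, div_div_div_eq]
  rw [mul_comm (_ * _ * _), mul_div_mul_right _ _ hpow₀]

lemma hasUnitDiscSeries_one_sub_cpow_neg_ofReal (δ : ℝ) :
    HasUnitDiscSeries (fun z => (1 - z) ^ (-δ : ℂ)) fun n => (rising δ n / (n ! : ℝ) : ℝ) :=
  (hasUnitDiscSeries_one_sub_cpow (-δ)).congr fun n => by
    have := n.factorial_ne_zero
    simp only [Complex.ofReal_div, ofReal_rising, ordinaryHypergeometricCoefficient, neg_neg,
      ascPochhammer_eval_one, Complex.ofReal_natCast]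
    field_simp

lemma one_sub_ofReal_cpow_ne_zero {x : ℝ} (hx : x < 1) (s : ℂ) : (1 - x : ℂ) ^ s ≠ 0 := by
  have : (1 - x : ℂ) ≠ 0 := by exact_mod_cast (sub_pos.2 hx).ne'
  simp [Complex.cpow_eq_zero_iff, this]

lemma tendsto_norm_one_sub_ofReal_cpow_neg {s : ℂ} (hs : 0 < s.re) :
    Tendsto (fun x : ℝ => ‖(1 - x : ℂ) ^ (-s)‖) (𝓝[<] 1) atTop := by
  simp only [Complex.cpow_neg]
  exact tendsto_norm_inv_nhdsNE_zero_atTop.comp (tendsto_nhdsWithin_iff.2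
    ⟨tendsto_one_sub_ofReal_cpow hs,
      eventually_nhdsWithin_of_forall fun x hx => one_sub_ofReal_cpow_ne_zero hx s⟩)

theorem tendsto_one_sub_cpow_mul_ordinaryHypergeometric (hα : ∀ n : ℕ, α + n ≠ 0)
    (hβ : ∀ n : ℕ, β + n ≠ 0) {δ : ℝ} (hδ : 0 < δ) (hαβ : α + β = γ + δ) :
    Tendsto (fun x : ℝ => (1 - x : ℂ) ^ (δ : ℂ) * ₂F₁ α β γ (x : ℂ)) (𝓝[<] 1)
      (𝓝 (Complex.Gamma γ * Complex.Gamma δ / (Complex.Gamma α * Complex.Gamma β))) := by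
  set L := Complex.Gamma γ * Complex.Gamma δ / (Complex.Gamma α * Complex.Gamma β)
  set d : ℕ → ℝ := fun n => rising δ n / (n ! : ℝ)
  have hrising (n : ℕ) : 0 < rising δ n := Finset.prod_pos fun i _ => by positivity
  have hd (n : ℕ) : 0 < d n := div_pos (hrising n) (by positivity)
  have hcoeff : (fun n => ordinaryHypergeometricCoefficient α β γ n - L * d n) =o[atTop] d := by
    rw [← Complex.isLittleO_ofReal_right]
    refine isLittleO_of_tendsto (fun n hn => by simp_all [(hd n).ne']) ?_
    refine (tendsto_sub_nhds_zero_iff.2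
      (tendsto_ascPochhammer_mul_div_mul hα hβ hαβ)).congr fun n => ?_
    have hd₀ : (d n : ℂ) ≠ 0 := Complex.ofReal_ne_zero.2 (hd n).ne'
    have hrising₀ : (rising δ n : ℂ) ≠ 0 := Complex.ofReal_ne_zero.2 (hrising n).ne'
    have := n.factorial_ne_zero
    rw [sub_div, mul_div_cancel_right₀ _ hd₀, sub_left_inj]
    simp only [d, ordinaryHypergeometricCoefficient, ← ofReal_rising, Complex.ofReal_div,
      Complex.ofReal_natCast]
    field_simp
  have hg := hasUnitDiscSeries_one_sub_cpow_neg_ofReal δ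
  have hf := (hasUnitDiscSeries_ordinaryHypergeometric α β γ).sub (hg.const_mul L)
  have hlim := (hf.isLittleO hg (fun n => (hd n).le) hcoeff
    (tendsto_norm_one_sub_ofReal_cpow_neg (by simpa using hδ))).tendsto_div_nhds_zero
  refine tendsto_sub_nhds_zero_iff.1 (hlim.congr' ?_)
  refine eventually_nhdsWithin_of_forall fun x hx => ?_
  have := one_sub_ofReal_cpow_ne_zero hx δ
  simp only [Complex.cpow_neg]
  field_simp

end SingularityAtOne

section ConnectionFormula

/-- The parameters for which all solutions at `1` and all their contiguous functions are defined and
none of the connection coefficients vanishes. -/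
structure IsGeneric (α β γ : ℂ) : Prop where
  left (n : ℤ) : α + n ≠ 0
  right (n : ℤ) : β + n ≠ 0
  sub_left (n : ℤ) : γ - α + n ≠ 0
  sub_right (n : ℤ) : γ - β + n ≠ 0
  sub_sub (n : ℤ) : γ - α - β + n ≠ 0
  third (n : ℕ) : γ + n ≠ 0

namespace IsGeneric

variable {α β γ : ℂ}

lemma symm (h : IsGeneric α β γ) : IsGeneric β α γ where
  left := h.right
  right := h.left
  sub_left := h.sub_right
  sub_right := h.sub_left
  sub_sub n := by simpa only [sub_right_comm] using h.sub_sub n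
  third := h.third

lemma add_intCast_left (h : IsGeneric α β γ) (m : ℤ) : IsGeneric (α + m) β γ where
  left n := by simpa [add_assoc] using h.left (m + n)
  right := h.right
  sub_left n := by
    convert h.sub_left (n - m) using 1
    push_cast
    ring
  sub_right := h.sub_right
  sub_sub n := by
    convert h.sub_sub (n - m) using 1
    push_cast
    ring
  third := h.third

lemma add_one_left_iff : IsGeneric (α + 1) β γ ↔ IsGeneric α β γ :=
  ⟨fun h => by simpa using h.add_intCast_left (-1), fun h => by simpa using h.add_intCast_left 1⟩

lemma left_ne_zero (h : IsGeneric α β γ) : α ≠ 0 := by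
  simpa using h.left 0

lemma sub_left_sub_one_ne_zero (h : IsGeneric α β γ) : γ - α - 1 ≠ 0 := by
  simpa [sub_eq_add_neg] using h.sub_left (-1)

lemma sub_sub_ne_zero (h : IsGeneric α β γ) : γ - α - β ≠ 0 := by
  simpa using h.sub_sub 0

lemma sub_sub_sub_one_ne_zero (h : IsGeneric α β γ) : γ - α - β - 1 ≠ 0 := by
  simpa [sub_eq_add_neg] using h.sub_sub (-1)

lemma sub_sub_add_natCast_ne_zero (h : IsGeneric α β γ) (n : ℕ) : γ - α - β + n ≠ 0 := by
  exact_mod_cast h.sub_sub n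

lemma add_sub_add_one_add_natCast_ne_zero (h : IsGeneric α β γ) (n : ℕ) :
    α + β - γ + 1 + n ≠ 0 := by
  convert neg_ne_zero.2 (h.sub_sub (-1 - n)) using 1
  push_cast
  ring

/-- Contiguity moves `β` and then `γ - α - β` into the unit interval. -/
theorem induction {γ : ℝ} {P : ℝ → ℝ → Prop} (symm : ∀ α β, P α β → P β α)
    (add_one_iff : ∀ α β : ℝ, IsGeneric α β γ → (P (α + 1) β ↔ P α β))
    (base : ∀ α β : ℝ, IsGeneric α β γ → β ∈ Ioo 0 1 → γ - α - β ∈ Ioo 0 1 → P α β)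
    {α β : ℝ} (h : IsGeneric α β γ) : P α β := by
  have hsymm (α β : ℝ) (hP : IsGeneric α β γ → P α β) (h : IsGeneric β α γ) : P β α :=
    symm _ _ (hP h.symm)
  have hleft (β : ℝ) : Function.Periodic (fun α : ℝ => IsGeneric α β γ → P α β) 1 := fun α => by
    simp only [Complex.ofReal_add, Complex.ofReal_one, add_one_left_iff]
    exact propext (forall_congr' (add_one_iff α β))
  have hright (α : ℝ) : Function.Periodic (fun β : ℝ => IsGeneric α β γ → P α β) 1 := fun β => by
    have heq := hleft α β
    simp only [eq_iff_iff] at heq ⊢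
    exact ⟨fun hP => hsymm _ _ (heq.1 (hsymm _ _ hP)), fun hP => hsymm _ _ (heq.2 (hsymm _ _ hP))⟩
  obtain ⟨β', hβ', heqβ⟩ := (hright α).exists_mem_Ico₀ one_pos β
  obtain ⟨α', hα', heqα⟩ := (hleft β').exists_mem_Ico one_pos α (γ - β' - 1)
  simp only [eq_iff_iff] at heqα heqβ
  refine heqβ.2 (heqα.2 fun h' => base α' β' h' ⟨hβ'.1.lt_of_ne ?_, hβ'.2⟩ ⟨?_, ?_⟩) h
  · rintro rfl
    simpa using h'.right 0
  · linarith [hα'.2]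
  · refine lt_of_le_of_ne (by linarith [hα'.1]) fun hs => h'.sub_sub (-1) ?_
    rw [← Complex.ofReal_sub, ← Complex.ofReal_sub, hs]
    simp

end IsGeneric

/-- The coefficient of `regularSolution α β γ` in `₂F₁ α β γ`. -/
noncomputable def regularCoeff (α β γ : ℂ) : ℂ :=
  Complex.Gamma γ * Complex.Gamma (γ - α - β) / (Complex.Gamma (γ - α) * Complex.Gamma (γ - β))

/-- The coefficient of `singularSolution α β γ` in `₂F₁ α β γ`. -/
noncomputable def singularCoeff (α β γ : ℂ) : ℂ :=
  Complex.Gamma γ * Complex.Gamma (α + β - γ) / (Complex.Gamma α * Complex.Gamma β)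

/-- Gauss's formula connecting the local solutions at `0` and at `1`. -/
def HasConnectionFormula (α β γ : ℂ) : Prop :=
  EqOn (₂F₁ α β γ)
    (fun z => regularCoeff α β γ * regularSolution α β γ z +
      singularCoeff α β γ * singularSolution α β γ z) lens

variable {α β γ : ℂ}

lemma regularCoeff_add_one_left (hγα : γ - α - 1 ≠ 0) (hs : γ - α - β - 1 ≠ 0) :
    regularCoeff (α + 1) β γ =
      (α - γ + 1) / (α + β - γ + 1) * regularCoeff α β γ := by
  have hΓ := Complex.Gamma_add_one _ hγα
  have hΓ' := Complex.Gamma_add_one _ hs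
  rw [sub_add_cancel] at hΓ hΓ'
  have hκ : (α - γ + 1) / (α + β - γ + 1) = (γ - α - 1) / (γ - α - β - 1) := by
    rw [← neg_div_neg_eq]
    congr 1 <;> ring
  rw [regularCoeff, regularCoeff, hΓ, hΓ', hκ, ← sub_sub, sub_right_comm _ 1 β]
  field_simp

lemma singularCoeff_add_one_left (hα : α ≠ 0) (hs : γ - α - β ≠ 0) :
    singularCoeff (α + 1) β γ = -((γ - α - β) / α) * singularCoeff α β γ := by
  have hs' : α + β - γ ≠ 0 := fun h => hs (by linear_combination -h)
  rw [singularCoeff, singularCoeff, Complex.Gamma_add_one _ hα,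
    show α + 1 + β - γ = α + β - γ + 1 by ring, Complex.Gamma_add_one _ hs']
  field_simp
  ring

lemma HasConnectionFormula.symm (h : HasConnectionFormula α β γ) : HasConnectionFormula β α γ := by
  intro z hz
  simpa only [regularCoeff, singularCoeff, regularSolution, singularSolution,
    ordinaryHypergeometric_comm α β, ordinaryHypergeometric_comm (γ - α), add_comm α β,
    sub_right_comm γ α β, mul_comm (Complex.Gamma (γ - α)), mul_comm (Complex.Gamma α)] using h hz

lemma IsGeneric.isContiguousPair_connection (h : IsGeneric α β γ) :
    IsContiguousPair α β γ
      (fun z => regularCoeff α β γ * regularSolution α β γ z +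
        singularCoeff α β γ * singularSolution α β γ z)
      (fun z => regularCoeff (α + 1) β γ * regularSolution (α + 1) β γ z +
        singularCoeff (α + 1) β γ * singularSolution (α + 1) β γ z) := by
  convert (isContiguousPair_regularSolution h.add_sub_add_one_add_natCast_ne_zero).linearCombination
    (isContiguousPair_singularSolution h.left_ne_zero h.sub_sub_add_natCast_ne_zero)
    (regularCoeff α β γ) (singularCoeff α β γ) using 2 with z
  rw [regularCoeff_add_one_left h.sub_left_sub_one_ne_zero h.sub_sub_sub_one_ne_zero,
    singularCoeff_add_one_left h.left_ne_zero h.sub_sub_ne_zero]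
  ring

lemma IsGeneric.hasBoundaryValues_connection (h : IsGeneric α β γ) (hs₀ : 0 < (γ - α - β).re)
    (hs₁ : (γ - α - β).re < 1) :
    HasBoundaryValues (γ - α - β)
      (fun z => regularCoeff α β γ * regularSolution α β γ z +
        singularCoeff α β γ * singularSolution α β γ z)
      (fun z => regularCoeff (α + 1) β γ * regularSolution (α + 1) β γ z +
        singularCoeff (α + 1) β γ * singularSolution (α + 1) β γ z)
      (regularCoeff α β γ) (singularCoeff (α + 1) β γ) := by
  rw [regularCoeff_add_one_left h.sub_left_sub_one_ne_zero h.sub_sub_sub_one_ne_zero,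
    singularCoeff_add_one_left h.left_ne_zero h.sub_sub_ne_zero]
  convert (hasBoundaryValues_regularSolution hs₁
    ((α - γ + 1) / (α + β - γ + 1))).linearCombination
    (hasBoundaryValues_singularSolution hs₀ (-((γ - α - β) / α)))
    (regularCoeff α β γ) (singularCoeff α β γ) using 1
  · funext z
    ring
  · ring
  · ring

lemma IsGeneric.hasConnectionFormula_add_one_left_iff (h : IsGeneric α β γ) :
    HasConnectionFormula (α + 1) β γ ↔ HasConnectionFormula α β γ :=
  ⟨(isContiguousPair_ordinaryHypergeometric h.third).eqOn_fst h.sub_left_sub_one_ne_zero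
      h.isContiguousPair_connection,
    (isContiguousPair_ordinaryHypergeometric h.third).eqOn_snd h.left_ne_zero
      h.isContiguousPair_connection⟩

lemma hasBoundaryValues_ordinaryHypergeometric {α β γ : ℝ} (h : IsGeneric α β γ) (hγ : 1 ≤ γ)
    (hβ : β ∈ Ioo 0 1) (hs : γ - α - β ∈ Ioo 0 1) :
    HasBoundaryValues (γ - α - β) (₂F₁ (α : ℂ) β γ) (₂F₁ (α + 1 : ℂ) β γ)
      (regularCoeff α β γ) (singularCoeff (α + 1) β γ) where
  tendsto_fst :=
    tendsto_ordinaryHypergeometric_one (by simpa using hβ.1)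
      (by simpa using hβ.2.trans_le hγ) (by simpa using hs.1)
  tendsto_snd := by
    have hlim := tendsto_one_sub_cpow_mul_ordinaryHypergeometric (α := α + 1) (β := β) (γ := γ)
      (fun n => by simpa [add_assoc] using h.left (1 + n)) (fun n => by simpa using h.right n)
      (sub_pos.2 hs.2) (by push_cast; ring)
    convert hlim using 2
    · push_cast
      rfl
    · rw [singularCoeff]
      push_cast
      ring_nf

theorem IsGeneric.hasConnectionFormula {α β γ : ℝ} (h : IsGeneric α β γ) (hγ : 1 ≤ γ) :
    HasConnectionFormula α β γ := by
  refine induction (P := fun α β => HasConnectionFormula α β γ) (fun _ _ => .symm)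
    (fun α β h => by simpa using h.hasConnectionFormula_add_one_left_iff)
    (fun α β h hβ hs => ?_) h
  exact (isContiguousPair_ordinaryHypergeometric h.third).eqOn_of_boundaryValues h.left_ne_zero
    h.add_sub_add_one_add_natCast_ne_zero h.sub_sub_add_natCast_ne_zero (by simpa using hs.1)
    (by simpa using hs.2) h.isContiguousPair_connection
    (hasBoundaryValues_ordinaryHypergeometric h hγ hβ hs)
    (h.hasBoundaryValues_connection (by simpa using hs.1) (by simpa using hs.2))

end ConnectionFormula

section CutPlaneContinuation

open MeasureTheory

variable {α β γ z : ℂ}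

/-- The complex plane cut along `[1, ∞)`. -/
def cutPlane : Set ℂ :=
  {z | 1 - z ∈ Complex.slitPlane}

lemma isOpen_cutPlane : IsOpen cutPlane :=
  Complex.isOpen_slitPlane.preimage (continuous_const.sub continuous_id)

lemma ball_subset_cutPlane : Metric.ball 0 1 ⊆ cutPlane := fun _ hz =>
  one_sub_mem_slitPlane (mem_ball_zero_iff.1 hz)

lemma starConvex_cutPlane {x : ℝ} (hx : x < 1) : StarConvex ℝ (x : ℂ) cutPlane := by
  refine StarConvex.affine_preimage (AffineEquiv.constVSub ℝ (1 : ℂ)).toAffineMap ?_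
  simpa using Complex.starConvex_ofReal_slitPlane (sub_pos.2 hx)

lemma ofReal_mul_mem_cutPlane (hz : z ∈ cutPlane) {t : ℝ} (ht : t ∈ Icc 0 1) :
    t * z ∈ cutPlane := by
  simpa using (starConvex_cutPlane one_pos).smul_mem hz ht.1 ht.2

lemma differentiableAt_setIntegral_mul {X : Type*} [TopologicalSpace X] [MeasurableSpace X]
    [OpensMeasurableSpace X] {μ : Measure X} {s K : Set X} {U : Set ℂ} {k : X → ℂ}
    {g g' : ℂ → X → ℂ} (hk : IntegrableOn k s μ) (hs : MeasurableSet s) (hK : IsCompact K)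
    (hsK : s ⊆ K) (hU : IsOpen U) (hg : ContinuousOn (Function.uncurry g) (U ×ˢ K))
    (hg' : ContinuousOn (Function.uncurry g') (U ×ˢ K))
    (hgg' : ∀ z ∈ U, ∀ t ∈ K, HasDerivAt (g · t) (g' z t) z) (hz : z ∈ U) :
    DifferentiableAt ℂ (fun z => ∫ t in s, k t * g z t ∂μ) z := by
  obtain ⟨r, hr, hrU⟩ := Metric.nhds_basis_closedBall.mem_iff.1 (hU.mem_nhds hz)
  have hcompact := (isCompact_closedBall z r).prod hK
  have hsubset : Metric.closedBall z r ×ˢ K ⊆ U ×ˢ K := prod_mono_left hrU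
  obtain ⟨M, hM⟩ := hcompact.exists_bound_of_continuousOn (hg.mono hsubset)
  obtain ⟨M', hM'⟩ := hcompact.exists_bound_of_continuousOn (hg'.mono hsubset)
  have hmeas {f : ℂ → X → ℂ} (hf : ContinuousOn (Function.uncurry f) (U ×ˢ K)) {w : ℂ}
      (hw : w ∈ U) : AEStronglyMeasurable (f w) (μ.restrict s) :=
    ((hf.uncurry_left w hw).mono hsK).aestronglyMeasurable hs
  have hzr := Metric.mem_closedBall_self (x := z) hr.le
  refine (hasDerivAt_integral_of_dominated_loc_of_deriv_le (F' := fun z t => k t * g' z t)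
    (bound := fun t => ‖k t‖ * M') (Metric.closedBall_mem_nhds z hr) ?_ ?_ ?_ ?_
    (hk.norm.mul_const M') ?_).2.differentiableAt
  · filter_upwards [Metric.closedBall_mem_nhds z hr] with w hw
    exact hk.aestronglyMeasurable.mul (hmeas hg (hrU hw))
  · exact hk.mul_bdd (hmeas hg hz)
      (ae_restrict_of_forall_mem hs fun t ht => hM (z, t) ⟨hzr, hsK ht⟩)
  · exact hk.aestronglyMeasurable.mul (hmeas hg' hz)
  · refine ae_restrict_of_forall_mem hs fun t ht w hw => ?_
    rw [norm_mul]
    exact mul_le_mul_of_nonneg_left (hM' (w, t) ⟨hw, hsK ht⟩) (norm_nonneg _)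
  · exact ae_restrict_of_forall_mem hs fun t ht w hw =>
      (hgg' w (hrU hw) t (hsK ht)).const_mul (k t)

lemma differentiableOn_eulerIntegral {u v : ℂ} (hu : 0 < u.re) (hv : 0 < v.re) (α : ℂ) :
    DifferentiableOn ℂ (eulerIntegral α u v) cutPlane := fun z hz => by
  refine (differentiableAt_setIntegral_mul (K := Icc 0 1)
    (g := fun z (t : ℝ) => (1 - t * z) ^ (-α))
    (g' := fun z (t : ℝ) => -α * (1 - t * z) ^ (-α - 1) * -t) (integrableOn_betaKernel hu hv)
    measurableSet_Ioo isCompact_Icc Ioo_subset_Icc_self isOpen_cutPlane ?_ ?_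
    (fun z hz t ht => ?_) hz).differentiableWithinAt
  · exact ContinuousOn.cpow_const (by fun_prop) fun p hp => ofReal_mul_mem_cutPlane hp.1 hp.2
  · refine (continuousOn_const.mul ?_).mul (by fun_prop)
    exact ContinuousOn.cpow_const (by fun_prop) fun p hp => ofReal_mul_mem_cutPlane hp.1 hp.2
  · have hlin : HasDerivAt (fun z : ℂ => 1 - t * z) (-t) z := by
      simpa using ((hasDerivAt_id z).const_mul (t : ℂ)).const_sub 1
    exact hlin.cpow_const (ofReal_mul_mem_cutPlane hz ht)

/-- `G` is the analytic continuation of `₂F₁ α β γ` to the cut plane. -/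
structure IsCutPlaneContinuation (α β γ : ℂ) (G : ℂ → ℂ) : Prop where
  differentiableOn : DifferentiableOn ℂ G cutPlane
  eqOn : EqOn G (₂F₁ α β γ) (Metric.ball 0 1)

namespace IsCutPlaneContinuation

variable {G : ℂ → ℂ}

lemma symm (h : IsCutPlaneContinuation α β γ G) : IsCutPlaneContinuation β α γ G :=
  ⟨h.differentiableOn, ordinaryHypergeometric_comm α β γ ▸ h.eqOn⟩

lemma add_one_left (h : IsCutPlaneContinuation α β γ G) (hα : α ≠ 0) :
    IsCutPlaneContinuation (α + 1) β γ fun z => (z * deriv G z + α * G z) / α where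
  differentiableOn := by
    have hG := h.differentiableOn
    have hG' := hG.deriv isOpen_cutPlane
    fun_prop
  eqOn z hz := by
    beta_reduce
    rw [h.eqOn.deriv Metric.isOpen_ball hz, h.eqOn hz,
      ordinaryHypergeometric_raise_left (mem_ball_zero_iff.1 hz), mul_div_cancel_left₀ _ hα]

lemma of_add_one_left (h : IsCutPlaneContinuation (α + 1) β γ G) (hγ : ∀ n : ℕ, γ + n ≠ 0)
    (hγα : γ - α - 1 ≠ 0) :
    IsCutPlaneContinuation α β γ fun z =>
      (z * (1 - z) * deriv G z + (γ - α - 1 - β * z) * G z) / (γ - α - 1) where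
  differentiableOn := by
    have hG := h.differentiableOn
    have hG' := hG.deriv isOpen_cutPlane
    fun_prop
  eqOn z hz := by
    beta_reduce
    rw [h.eqOn.deriv Metric.isOpen_ball hz, h.eqOn hz,
      ordinaryHypergeometric_lower_left hγ (mem_ball_zero_iff.1 hz), mul_div_cancel_left₀ _ hγα]

end IsCutPlaneContinuation

theorem isCutPlaneContinuation_eulerIntegral (hβ : 0 < β.re) (hγβ : 0 < (γ - β).re) :
    IsCutPlaneContinuation α β γ fun z =>
      eulerIntegral α β (γ - β) z / Complex.betaIntegral β (γ - β) where
  differentiableOn := (differentiableOn_eulerIntegral hβ hγβ α).div_const _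
  eqOn z hz := by
    beta_reduce
    rw [eulerIntegral_eq hβ hγβ (mem_ball_zero_iff.1 hz),
      mul_div_cancel_left₀ _ (betaIntegral_ne_zero hβ hγβ),
      add_sub_cancel]

theorem IsGeneric.exists_isCutPlaneContinuation {α β γ : ℝ} (h : IsGeneric α β γ) (hγ : 1 ≤ γ) :
    ∃ G, IsCutPlaneContinuation α β γ G := by
  refine induction (P := fun α β => ∃ G, IsCutPlaneContinuation α β γ G)
    (fun _ _ ⟨G, hG⟩ => ⟨G, hG.symm⟩) (fun α β h => ?_) (fun α β _ hβ _ => ?_) h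
  · rw [Complex.ofReal_add, Complex.ofReal_one]
    exact ⟨fun ⟨G, hG⟩ => ⟨_, hG.of_add_one_left h.third h.sub_left_sub_one_ne_zero⟩,
      fun ⟨G, hG⟩ => ⟨_, hG.add_one_left h.left_ne_zero⟩⟩
  · exact ⟨_, isCutPlaneContinuation_eulerIntegral (by simpa using hβ.1)
      (by simpa using hβ.2.trans_le hγ)⟩

lemma differentiableAt_regularSolution (hz : ‖1 - z‖ < 1) :
    DifferentiableAt ℂ (regularSolution α β γ) z :=
  (differentiableAt_ordinaryHypergeometric hz).comp z (by fun_prop)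

lemma differentiableAt_singularSolution (hz : z ∈ cutPlane) (hz₁ : ‖1 - z‖ < 1) :
    DifferentiableAt ℂ (singularSolution α β γ) z :=
  (hasDerivAt_one_sub_cpow hz _).differentiableAt.mul
    ((differentiableAt_ordinaryHypergeometric hz₁).comp z (by fun_prop))

/-- The identity theorem extends the connection formula from the lens to the largest domain on which
its right-hand side is given by power series at `1`. -/
theorem IsCutPlaneContinuation.eq_connection {G : ℂ → ℂ} (hG : IsCutPlaneContinuation α β γ G)
    (h : HasConnectionFormula α β γ) (hz : z ∈ cutPlane) (hz₁ : ‖1 - z‖ < 1) :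
    G z = regularCoeff α β γ * regularSolution α β γ z +
      singularCoeff α β γ * singularSolution α β γ z := by
  set V : Set ℂ := cutPlane ∩ Metric.ball 1 1
  have hVo : IsOpen V := isOpen_cutPlane.inter Metric.isOpen_ball
  have hhalf : ((1 / 2 : ℝ) : ℂ) ∈ lens := ofReal_mem_lens (by norm_num)
  have hhalfV : ((1 / 2 : ℝ) : ℂ) ∈ V := ⟨ball_subset_cutPlane hhalf.1, hhalf.2⟩
  have hVc : IsPreconnected V := (((starConvex_cutPlane (by norm_num)).inter
    ((convex_ball 1 1).starConvex hhalf.2)).isPathConnected hhalfV).isConnected.isPreconnected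
  have hdiff : DifferentiableOn ℂ (fun z => regularCoeff α β γ * regularSolution α β γ z +
      singularCoeff α β γ * singularSolution α β γ z) V := fun z hz => by
    have hz' : ‖1 - z‖ < 1 := by simpa [dist_eq_norm, norm_sub_rev] using hz.2
    exact (((differentiableAt_regularSolution hz').const_mul _).add
      ((differentiableAt_singularSolution hz.1 hz').const_mul _)).differentiableWithinAt
  refine ((hG.differentiableOn.mono inter_subset_left).analyticOnNhd
    hVo).eqOn_of_preconnected_of_eventuallyEq (hdiff.analyticOnNhd hVo) hVc hhalfV ?_
      ⟨hz, by simpa [dist_eq_norm, norm_sub_rev] using hz₁⟩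
  filter_upwards [isOpen_lens.mem_nhds hhalf] with w hw
  exact (hG.eqOn hw.1).trans (h hw)

end CutPlaneContinuation

section DeltaExpansion

variable {φ σ A : ℝ} {G p q : ℂ → ℂ} {c d : ℕ → ℂ} {z : ℂ}

lemma mem_cutPlane_of_arg_ne_zero (hz : Complex.arg (z - 1) ≠ 0) : z ∈ cutPlane := by
  contrapose! hz
  have hre : 1 ≤ z.re ∧ z.im = 0 := by simpa [cutPlane, Complex.mem_slitPlane_iff] using hz
  exact Complex.arg_eq_zero_iff.2 (by simpa using hre)

lemma deltaDomain_subset_cutPlane (hφ : 0 ≤ φ) (η : ℝ) : deltaDomain φ η ⊆ cutPlane :=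
  fun _ hz => mem_cutPlane_of_arg_ne_zero (abs_pos.1 (hφ.trans_lt hz.2))

lemma exists_isCompact_deltaDomain (hφ : 0 < φ) (hφπ : φ ≤ Real.pi) (η : ℝ) {ρ : ℝ} (hρ : 0 < ρ) :
    ∃ K ⊆ cutPlane, IsCompact K ∧ deltaDomain φ η \ Metric.ball 1 ρ ⊆ K := by
  refine ⟨Metric.closedBall 0 (1 + η) ∩
    ({z | (z - 1).re ≤ ‖z - 1‖ * Real.cos φ} ∩ {z | ρ ≤ ‖z - 1‖}), ?_, ?_, ?_⟩
  · rintro z ⟨-, (hre : (z - 1).re ≤ ‖z - 1‖ * Real.cos φ), hρz⟩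
    refine mem_cutPlane_of_arg_ne_zero fun harg => ?_
    have hcos : Real.cos φ < 1 :=
      Real.cos_zero ▸ Real.cos_lt_cos_of_nonneg_of_le_pi le_rfl hφπ hφ
    have hnorm := Complex.norm_mul_cos_arg (z - 1)
    rw [harg, Real.cos_zero, mul_one] at hnorm
    exact hre.not_gt (hnorm ▸ mul_lt_of_lt_one_right (hρ.trans_le hρz) hcos)
  · exact (isCompact_closedBall _ _).inter_right
      ((isClosed_le (by fun_prop) (by fun_prop)).inter (isClosed_le (by fun_prop) (by fun_prop)))
  · rintro z ⟨⟨hη, harg⟩, hρz⟩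
    rw [Metric.mem_ball, not_lt, dist_eq_norm] at hρz
    refine ⟨mem_closedBall_zero_iff.2 hη.le, ?_, hρz⟩
    change (z - 1).re ≤ ‖z - 1‖ * Real.cos φ
    rw [← Complex.norm_mul_cos_arg, ← Real.cos_abs]
    gcongr
    exact Real.cos_le_cos_of_nonneg_of_le_pi hφ.le (Complex.abs_arg_le_pi _) harg.le

/-- Away from `1`, a `Δ`-domain is contained in a compact subset of the cut plane. -/
theorem isBigO_principal_deltaDomain {E F : Type*} [NormedAddCommGroup E] [NormedAddCommGroup F]
    {f : ℂ → E} {g : ℂ → F} (hf : ContinuousOn f cutPlane) (hg : ContinuousOn g cutPlane)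
    (hg₀ : ∀ z ∈ cutPlane, g z ≠ 0) (hfg : f =O[𝓝[cutPlane] 1] g) (hφ : 0 < φ)
    (hφπ : φ ≤ Real.pi) (η : ℝ) : f =O[𝓟 (deltaDomain φ η)] g := by
  obtain ⟨C, hC⟩ := hfg.bound
  obtain ⟨ρ, hρ, hnear⟩ := Metric.mem_nhdsWithin_iff.1 hC
  obtain ⟨K, hK, hKc, hfar⟩ := exists_isCompact_deltaDomain hφ hφπ η hρ
  have hnearO : f =O[𝓟 (Metric.ball 1 ρ ∩ cutPlane)] g := isBigO_principal.2 ⟨C, hnear⟩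
  have hfarO : f =O[𝓟 K] g :=
    ((hf.mono hK).isBigO_principal hKc (c := (1 : ℝ)) (by simp)).trans
      ((hg.mono hK).isBigO_rev_principal hKc (fun z hz => hg₀ z (hK hz)) 1)
  refine (hnearO.sup hfarO).mono ?_
  rw [sup_principal, principal_mono]
  intro z hz
  by_cases hzρ : z ∈ Metric.ball 1 ρ
  · exact .inl ⟨hzρ, deltaDomain_subset_cutPlane hφ.le η hz⟩
  · exact .inr (hfar ⟨hz, hzρ⟩)

lemma ne_zero_of_mem_cutPlane (hz : z ∈ cutPlane) : 1 - z ≠ 0 :=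
  Complex.slitPlane_ne_zero hz

lemma tendsto_one_sub_nhdsWithin_cutPlane :
    Tendsto (fun z : ℂ => 1 - z) (𝓝[cutPlane] 1) (𝓝 0) :=
  tendsto_nhdsWithin_of_tendsto_nhds (Continuous.tendsto' (by fun_prop) 1 0 (sub_self 1))

lemma HasUnitDiscSeries.isBigO_sub_sum (hp : HasUnitDiscSeries p c) (n : ℕ) :
    (fun w => p w - ∑ k ∈ Finset.range n, c k * w ^ k) =O[𝓝 0] fun w => ‖w‖ ^ n := by
  simpa [FormalMultilinearSeries.partialSum, FormalMultilinearSeries.ofScalars_apply_eq,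
    mul_comm] using
    hp.hasFPowerSeriesOnBall.hasFPowerSeriesAt.isBigO_sub_partialSum_pow n

lemma isBigO_norm_pow_rpow {n : ℕ} (hA : A ≤ n) :
    (fun z : ℂ => ‖1 - z‖ ^ n) =O[𝓝[cutPlane] 1] fun z => ‖1 - z‖ ^ A := by
  refine IsBigO.of_bound' ?_
  filter_upwards [self_mem_nhdsWithin,
    tendsto_one_sub_nhdsWithin_cutPlane (Metric.closedBall_mem_nhds 0 one_pos)] with z hz hz₁
  rw [Real.norm_of_nonneg (by positivity), Real.norm_of_nonneg (by positivity),
    ← Real.rpow_natCast]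
  exact Real.rpow_le_rpow_of_exponent_ge (norm_pos_iff.2 (ne_zero_of_mem_cutPlane hz))
    (by simpa using hz₁) hA

lemma HasUnitDiscSeries.isBigO_comp_one_sub (hp : HasUnitDiscSeries p c) (A : ℝ) :
    (fun z => p (1 - z) - ∑ k ∈ Finset.range ⌈A⌉₊, c k * (1 - z) ^ k) =O[𝓝[cutPlane] 1]
      fun z => ‖1 - z‖ ^ A :=
  ((hp.isBigO_sub_sum _).comp_tendsto tendsto_one_sub_nhdsWithin_cutPlane).trans
    (isBigO_norm_pow_rpow (Nat.le_ceil A))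

lemma HasUnitDiscSeries.isBigO_cpow_mul_comp_one_sub (hq : HasUnitDiscSeries q d) (σ A : ℝ) :
    (fun z => (1 - z) ^ (σ : ℂ) *
      (q (1 - z) - ∑ k ∈ Finset.range ⌈A - σ⌉₊, d k * (1 - z) ^ k)) =O[𝓝[cutPlane] 1]
      fun z => ‖1 - z‖ ^ A := by
  have hpow : (fun z : ℂ => (1 - z) ^ (σ : ℂ)) =O[𝓝[cutPlane] 1] fun z => ‖1 - z‖ ^ σ :=
    .of_bound' (.of_forall fun z => by
      rw [Complex.norm_cpow_real, Real.norm_of_nonneg (by positivity)])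
  refine (hpow.mul (hq.isBigO_comp_one_sub (A - σ))).congr' .rfl ?_
  filter_upwards [self_mem_nhdsWithin] with z hz
  rw [← Real.rpow_add (norm_pos_iff.2 (ne_zero_of_mem_cutPlane hz)), add_sub_cancel]

lemma sum_disjSum_cpow (c d : ℕ → ℂ) (σ : ℝ) (m n : ℕ) (hz : z ∈ cutPlane) :
    ∑ i ∈ (Finset.range m).disjSum (Finset.range n), Sum.elim c d i *
        (1 - z) ^ ((Sum.elim (fun k : ℕ => (k : ℝ)) (fun k : ℕ => σ + k) i : ℝ) : ℂ) =
      ∑ k ∈ Finset.range m, c k * (1 - z) ^ k +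
        (1 - z) ^ (σ : ℂ) * ∑ k ∈ Finset.range n, d k * (1 - z) ^ k := by
  simp only [Finset.sum_disjSum, Sum.elim_inl, Sum.elim_inr, Finset.mul_sum, Complex.ofReal_add,
    Complex.ofReal_natCast, Complex.cpow_add _ _ (ne_zero_of_mem_cutPlane hz),
    Complex.cpow_natCast, mul_left_comm]

theorem exists_hasSingularExpansionOn (hG : ContinuousOn G cutPlane) (hp : HasUnitDiscSeries p c)
    (hq : HasUnitDiscSeries q d)
    (hGpq : ∀ᶠ z in 𝓝[cutPlane] 1, G z = p (1 - z) + (1 - z) ^ (σ : ℂ) * q (1 - z))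
    (hφ : 0 < φ) (hφπ : φ ≤ Real.pi) (η A : ℝ) :
    ∃ s : Finset (ℕ ⊕ ℕ),
      (∀ i, i ∈ s ↔ Sum.elim (fun k : ℕ => (k : ℝ)) (fun k : ℕ => σ + k) i < A) ∧
      HasSingularExpansionOn G φ η s (Sum.elim c d)
        (Sum.elim (fun k : ℕ => (k : ℝ)) (fun k : ℕ => σ + k)) A := by
  set s := (Finset.range ⌈A⌉₊).disjSum (Finset.range ⌈A - σ⌉₊)
  have hs (i) : i ∈ s ↔ Sum.elim (fun k : ℕ => (k : ℝ)) (fun k : ℕ => σ + k) i < A := by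
    cases i <;> simp [s, Nat.lt_ceil, lt_sub_iff_add_lt']
  refine ⟨s, hs, fun i => (hs i).1,
    isBigO_principal_deltaDomain (hG.sub ?_) ?_ (fun z hz => ?_) ?_ hφ hφπ η⟩
  · exact continuousOn_finsetSum _ fun i _ => continuousOn_const.mul
      (ContinuousOn.cpow_const (by fun_prop) fun z hz => hz)
  · exact ContinuousOn.rpow_const (by fun_prop) fun z hz =>
      .inl (norm_ne_zero_iff.2 (ne_zero_of_mem_cutPlane hz))
  · exact (Real.rpow_pos_of_pos (norm_pos_iff.2 (ne_zero_of_mem_cutPlane hz)) A).ne'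
  · refine ((hp.isBigO_comp_one_sub A).add (hq.isBigO_cpow_mul_comp_one_sub σ A)).congr' ?_ .rfl
    filter_upwards [hGpq, self_mem_nhdsWithin] with z hGz hz
    rw [Pi.sub_apply, hGz, sum_disjSum_cpow c d σ _ _ hz]
    ring

lemma injective_sumElim_natCast_add (hσ : ∀ m : ℤ, σ ≠ m) :
    Function.Injective (Sum.elim (fun k : ℕ => (k : ℝ)) (fun k : ℕ => σ + k)) := by
  have hne (i j : ℕ) : (i : ℝ) ≠ σ + j := fun h => hσ (i - j) (by push_cast; linarith)
  exact Nat.cast_injective.sumElim ((add_right_injective σ).comp Nat.cast_injective) hne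

lemma HasInfiniteDeltaExpansion.isDeltaRegular {ι : Type*} {f : ℂ → ℂ} {c : ι → ℂ} {α : ι → ℝ}
    (h : HasInfiniteDeltaExpansion f c α) : IsDeltaRegular f :=
  let ⟨hf, _, _, φ, η, hφ, hφ', hη, F, hF, _⟩ := h
  ⟨hf, φ, η, hφ, hφ', hη, F, hF⟩

end DeltaExpansion

section HypergeometricExpansion

lemma IsGeneric.isTaylorOfRadiusOne {α β γ : ℂ} (h : IsGeneric α β γ) :
    IsTaylorOfRadiusOne (₂F₁ α β γ) := by
  refine ⟨ordinaryHypergeometricSeries ℂ α β γ, ordinaryHypergeometricSeries_radius_eq_one ℂ _ _ _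
    fun n => ?_, (hasUnitDiscSeries_ordinaryHypergeometric α β γ).hasFPowerSeriesOnBall⟩
  simp only [ne_eq, eq_neg_iff_add_eq_zero, add_comm (n : ℂ)]
  exact ⟨mod_cast h.left n, mod_cast h.right n, h.third n⟩

lemma IsCutPlaneContinuation.isDeltaContinuation {α β γ : ℂ} {G : ℂ → ℂ}
    (hG : IsCutPlaneContinuation α β γ G) {φ : ℝ} (hφ : 0 ≤ φ) (η : ℝ) :
    IsDeltaContinuation (₂F₁ α β γ) φ η G :=
  ⟨hG.differentiableOn.mono (deltaDomain_subset_cutPlane hφ η), hG.eqOn⟩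

theorem IsGeneric.hasInfiniteDeltaExpansion {α β γ : ℝ} (h : IsGeneric α β γ) (hγ : 1 ≤ γ) :
    HasInfiniteDeltaExpansion (₂F₁ (α : ℂ) (β : ℂ) (γ : ℂ))
      (Sum.elim
        (fun k => regularCoeff α β γ *
          ordinaryHypergeometricCoefficient (α : ℂ) β (α + β - γ + 1) k)
        (fun k => singularCoeff α β γ *
          ordinaryHypergeometricCoefficient (γ - α : ℂ) (γ - β) (γ - α - β + 1) k))
      (Sum.elim (fun k : ℕ => (k : ℝ)) (fun k : ℕ => γ - α - β + k)) := by
  obtain ⟨G, hG⟩ := h.exists_isCutPlaneContinuation hγ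
  have hlocal : ∀ᶠ z in 𝓝[cutPlane] 1,
      G z = regularCoeff α β γ * ₂F₁ (α : ℂ) (β : ℂ) (α + β - γ + 1 : ℂ) (1 - z) +
        (1 - z) ^ ((γ - α - β : ℝ) : ℂ) * (singularCoeff α β γ *
          ₂F₁ (γ - α : ℂ) (γ - β : ℂ) (γ - α - β + 1 : ℂ) (1 - z)) := by
    filter_upwards [self_mem_nhdsWithin,
      tendsto_one_sub_nhdsWithin_cutPlane (Metric.ball_mem_nhds 0 one_pos)] with z hz hz₁
    rw [hG.eq_connection (h.hasConnectionFormula hγ) hz (mem_ball_zero_iff.1 hz₁),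
      regularSolution, singularSolution, mul_left_comm]
    push_cast
    rfl
  have hσ (m : ℤ) : γ - α - β ≠ m := fun hm => h.sub_sub (-m) <| by
    rw [← Complex.ofReal_sub, ← Complex.ofReal_sub, hm]
    push_cast
    ring
  have hpi := Real.pi_pos
  exact ⟨h.isTaylorOfRadiusOne, inferInstance, injective_sumElim_natCast_add hσ, Real.pi / 4, 1,
    by positivity, by linarith, one_pos, G, hG.isDeltaContinuation (by positivity) 1,
    exists_hasSingularExpansionOn hG.differentiableOn.continuousOn
      ((hasUnitDiscSeries_ordinaryHypergeometric _ _ _).const_mul _)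
      ((hasUnitDiscSeries_ordinaryHypergeometric _ _ _).const_mul _) hlocal
      (by positivity) (by linarith) 1⟩

lemma HasInfiniteDeltaExpansion.congr {ι : Type*} {f g : ℂ → ℂ} {c : ι → ℂ} {α : ι → ℝ}
    (h : HasInfiniteDeltaExpansion f c α) (hfg : EqOn f g (Metric.ball 0 1)) :
    HasInfiniteDeltaExpansion g c α := by
  obtain ⟨⟨p, hp, hf⟩, hι, hα, φ, η, hφ, hφ', hη, F, ⟨hF, hFf⟩, hexp⟩ := h
  refine ⟨⟨p, hp, hf.congr ?_⟩, hι, hα, φ, η, hφ, hφ', hη, F, ⟨hF, hFf.trans hfg⟩, hexp⟩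
  rwa [← ENNReal.ofReal_one, Metric.eball_ofReal]

end HypergeometricExpansion

section HadamardProduct

variable {a b : ℝ}

lemma isGeneric_neg_neg_one (ha : ∀ m : ℤ, a ≠ m) (hb : ∀ m : ℤ, b ≠ m)
    (hab : ∀ m : ℤ, a + b ≠ m) : IsGeneric ((-a : ℝ) : ℂ) ((-b : ℝ) : ℂ) ((1 : ℝ) : ℂ) where
  left n h := ha n (by norm_cast at h; linarith)
  right n h := hb n (by norm_cast at h; linarith)
  sub_left n h := ha (-1 - n) (by norm_cast at h; push_cast at h ⊢; linarith)
  sub_right n h := hb (-1 - n) (by norm_cast at h; push_cast at h ⊢; linarith)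
  sub_sub n h := hab (-1 - n) (by norm_cast at h; push_cast at h ⊢; linarith)
  third n := by exact_mod_cast (add_comm 1 n).trans_ne n.succ_ne_zero

lemma taylorCoeffZero_oneSubPow (a : ℝ) (n : ℕ) :
    taylorCoeffZero (oneSubPow a) n = ordinaryHypergeometricCoefficient (-a : ℂ) 1 1 n :=
  (hasUnitDiscSeries_one_sub_cpow (a : ℂ)).taylorCoeffZero_eq n

lemma ordinaryHypergeometricCoefficient_one_one_mul (α β : ℂ) (n : ℕ) :
    ordinaryHypergeometricCoefficient α 1 1 n * ordinaryHypergeometricCoefficient β 1 1 n =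
      ordinaryHypergeometricCoefficient α β 1 n := by
  have hn : (n.factorial : ℂ) ≠ 0 := mod_cast n.factorial_ne_zero
  simp only [ordinaryHypergeometricCoefficient, ascPochhammer_eval_one]
  field_simp

theorem hasSum_taylorCoeffZero_oneSubPow_mul (a b : ℝ) {z : ℂ} (hz : ‖z‖ < 1) :
    HasSum
      (fun n => taylorCoeffZero (oneSubPow a) n * taylorCoeffZero (oneSubPow b) n * z ^ n)
      (₂F₁ (-a : ℂ) (-b : ℂ) 1 z) := by
  simpa only [taylorCoeffZero_oneSubPow, ordinaryHypergeometricCoefficient_one_one_mul] using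
    hasUnitDiscSeries_ordinaryHypergeometric (-a : ℂ) (-b) 1 hz

lemma ofReal_lambdaCoeff_div_factorial (a b : ℝ) (k : ℕ) :
    ((lambdaCoeff a b k / (k.factorial : ℝ) : ℝ) : ℂ) =
      regularCoeff (-a) (-b) 1 *
        ordinaryHypergeometricCoefficient (-a : ℂ) (-b) (-a + -b - 1 + 1) k := by
  rw [lambdaCoeff, regularCoeff, ordinaryHypergeometricCoefficient, sub_add_cancel,
    ← sub_eq_add_neg, Complex.Gamma_one]
  push_cast [ofReal_rising, ← Complex.Gamma_ofReal]
  simp only [sub_neg_eq_add]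
  ring

lemma ofReal_muCoeff_div_factorial (a b : ℝ) (k : ℕ) :
    ((muCoeff a b k / (k.factorial : ℝ) : ℝ) : ℂ) =
      singularCoeff (-a) (-b) 1 *
        ordinaryHypergeometricCoefficient (1 - -a : ℂ) (1 - -b) (1 - -a - -b + 1) k := by
  rw [muCoeff, singularCoeff, ordinaryHypergeometricCoefficient, Complex.Gamma_one,
    show (1 - -a - -b + 1 : ℂ) = 2 + a + b by ring]
  push_cast [ofReal_rising, ← Complex.Gamma_ofReal]
  simp only [sub_neg_eq_add, ← sub_eq_add_neg]
  ring

theorem hadamardProduct_oneSubPow (a b : ℝ) {z : ℂ} (hz : ‖z‖ < 1) :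
    hadamardProduct (oneSubPow a) (oneSubPow b) z = ₂F₁ (-a : ℂ) (-b : ℂ) 1 z :=
  (hasSum_taylorCoeffZero_oneSubPow_mul a b hz).tsum_eq

end HadamardProduct

theorem mainTheorem4 (a b : ℝ) (ha : ∀ m : ℤ, a ≠ m) (hb : ∀ m : ℤ, b ≠ m)
    (hab : ∀ m : ℤ, a + b ≠ m) :
    (∀ z : ℂ, ‖z‖ < 1 →
      HasSum
        (fun n : ℕ => taylorCoeffZero (oneSubPow a) n * taylorCoeffZero (oneSubPow b) n * z ^ n)
        (ordinaryHypergeometric (-a : ℂ) (-b : ℂ) (1 : ℂ) z) ∧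
      hadamardProduct (oneSubPow a) (oneSubPow b) z =
        ordinaryHypergeometric (-a : ℂ) (-b : ℂ) (1 : ℂ) z) ∧
    IsDeltaRegular (hadamardProduct (oneSubPow a) (oneSubPow b)) ∧
    HasInfiniteDeltaExpansion (ι := ℕ ⊕ ℕ)
      (hadamardProduct (oneSubPow a) (oneSubPow b))
      (Sum.elim (fun k : ℕ => ((lambdaCoeff a b k / (k.factorial : ℝ) : ℝ) : ℂ))
        (fun k : ℕ => ((muCoeff a b k / (k.factorial : ℝ) : ℝ) : ℂ)))
      (Sum.elim (fun k : ℕ => (k : ℝ)) (fun k : ℕ => a + b + 1 + (k : ℝ))) := by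
  have h := isGeneric_neg_neg_one ha hb hab
  have hexp := (h.hasInfiniteDeltaExpansion le_rfl).congr
    (g := hadamardProduct (oneSubPow a) (oneSubPow b)) fun z hz => by
      rw [hadamardProduct_oneSubPow a b (mem_ball_zero_iff.1 hz)]
      push_cast
      rfl
  have hexponent : 1 - -a - -b = a + b + 1 := by ring
  simp only [hexponent, Complex.ofReal_neg, Complex.ofReal_one, ← ofReal_lambdaCoeff_div_factorial,
    ← ofReal_muCoeff_div_factorial] at hexp
  exact ⟨fun z hz =>
    ⟨hasSum_taylorCoeffZero_oneSubPow_mul a b hz, hadamardProduct_oneSubPow a b hz⟩,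
    hexp.isDeltaRegular, hexp⟩
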